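/- **Setting.** Let $\mathfrak g$ be a real Lie algebra with a basis $e_1,\dots,e_n,u_1,\dots,u_4$ whose brackets are one of those listed below; $\mathfrak h=\mathrm{span}(e_i)$ is a subalgebra and $\mathfrak m=\mathrm{span}(u_j)\cong\mathfrak g/\mathfrak h$. Such a pair describes (locally) a four-dimensional homogeneous space $M=G/H$ with $H$ connected and non-trivial. Write $x_{\mathfrak m}$ for the $\mathfrak m$-component of $x\in\mathfrak g$. Only non-zero brackets of basis vectors are listed; parameters are real. * $1.1^1$: $[e_1,u_1]=u_1,\ [e_1,u_3]=-u_3$, together with * (1) $[u_1,u_3]=u_2,\ [u_2,u_4]=u_2,\ [u_3,u_4]=u_3$; * (2) $[u_2,u_4]=pu_2,\ [u_3,u_4]=u_3$; * (5) $[u_1,u_3]=e_1,\ [u_2,u_4]=u_2$. * $1.1^2$: $[e_1,u_1]=u_3,\ [e_1,u_3]=-u_1$, together with * (1) $[u_1,u_3]=-u_2,\ [u_1,u_4]=u_1,\ [u_2,u_4]=2u_2,\ [u_3,u_4]=u_3$; * (2) $[u_1,u_4]=u_1,\ [u_2,u_4]=pu_2,\ [u_3,u_4]=u_3$; * (6),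 (7) $[u_1,u_3]=\varepsilon e_1,\ [u_2,u_4]=u_2$, with $\varepsilon=1$ for (6), $\varepsilon=-1$ for (7). * $1.3^1$: $[e_1,u_3]=u_1,\ [e_1,u_4]=u_2$, together with * (1) $[e_1,u_1]=e_1,\ [u_1,u_2]=-\tfrac12u_2,\ [u_1,u_3]=u_3,\ [u_1,u_4]=\tfrac12u_4,\ [u_2,u_3]=\tfrac12u_4$; * (2) $[u_1,u_3]=-pe_1+(p+1)u_1+pu_2,\ [u_2,u_4]=u_2$, $|p|\le1$; * (3) $[u_1,u_3]=u_1,\ [u_2,u_4]=u_2,\ [u_3,u_4]=e_1$; * (5) $[u_1,u_3]=-\tfrac{p^2+q}{q-1}e_1+\tfrac{1+p^2}{q-1}u_2,\ [u_1,u_4]=[u_2,u_3]=-pe_1+u_1+pu_2,\ [u_2,u_4]=-qe_1+(q+1)u_2$, $p\ge0$, $q\ne1$; * (6) $[u_1,u_3]=-u_2,\ [u_1,u_4]=u_1,\ [u_2,u_3]=u_1,\ [u_2,u_4]=u_2,\ [u_3,u_4]=e_1$; * (7) $[u_1,u_3]=\tfrac{1}{1+p}(e_1+pu_1-u_2),\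 [u_1,u_4]=[u_2,u_3]=\tfrac1{1+p}(-e_1+u_1+u_2),\ [u_2,u_4]=\tfrac1{1+p}(-pe_1+pu_1+(1+2p)u_2)$, $p\ne-1$; * (8) $[u_2,u_3]=u_1,\ [u_2,u_4]=u_2,\ [u_3,u_4]=-u_3$; * (9) $[u_2,u_3]=pu_1,\ [u_2,u_4]=-pe_1+(p+1)u_2,\ [u_3,u_4]=-pu_3$, $p\ne0$; * (11) $[u_2,u_3]=-u_1,\ [u_2,u_4]=e_1,\ [u_3,u_4]=e_1+u_3$; * (12) $[u_1,u_4]=u_1,\ [u_2,u_3]=qu_1,\ [u_2,u_4]=-pqe_1+(p+q)u_2,\ [u_3,u_4]=(1-q)u_3$; * (13) $[u_1,u_4]=u_1,\ [u_2,u_3]=\tfrac12u_1,\ [u_2,u_4]=-\tfrac p2e_1+(p+\tfrac12)u_2,\ [u_3,u_4]=e_1+\tfrac12u_3$; * (14) $[u_1,u_4]=u_1,\ [u_2,u_3]=(1-p)u_1,\ [u_2,u_4]=p(p-1)e_1+u_2,\ [u_3,u_4]=e_1+pu_3$, $p\ne\tfrac12$; * (19) $[u_1,u_4]=u_1,\ [u_2,u_3]=u_1,\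 [u_2,u_4]=-e_1+u_1+2u_2$; * (20) $[u_2,u_3]=u_1,\ [u_2,u_4]=-u_1+u_2,\ [u_3,u_4]=-u_3$; * (21) $[u_1,u_4]=u_1,\ [u_2,u_3]=pu_1,\ [u_2,u_4]=-pe_1+(1-p)u_1+(1+p)u_2,\ [u_3,u_4]=(1-p)u_3$, $p\ne1$; * (22) $[u_1,u_4]=u_1,\ [u_2,u_3]=\tfrac12u_1,\ [u_2,u_4]=-\tfrac12e_1+\tfrac12u_1+\tfrac32u_2,\ [u_3,u_4]=e_1+\tfrac12u_3$; * (28) $[u_1,u_3]=2u_1,\ [u_1,u_4]=2u_2,\ [u_2,u_3]=u_2,\ [u_2,u_4]=e_1-\tfrac12u_1,\ [u_3,u_4]=u_4$. * $1.4^1$: $[e_1,u_2]=u_1,\ [e_1,u_3]=u_2$, together with * (2) $[e_1,u_4]=e_1,\ [u_1,u_4]=pu_1,\ [u_2,u_4]=(p-1)u_2,\ [u_3,u_4]=(p-2)u_3$; * (9) $[u_1,u_3]=u_1,\ [u_2,u_3]=re_1+u_2+u_4,\ [u_3,u_4]=pu_4$; * (10) $[u_1,u_3]=u_1,\ [u_2,u_3]=re_1+u_2,\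 [u_3,u_4]=pu_4$; * (11) $[u_1,u_3]=u_1,\ [u_2,u_3]=re_1+u_2+u_4,\ [u_3,u_4]=u_1-u_4$; * (12) $[u_1,u_3]=u_1,\ [u_2,u_3]=re_1+u_2,\ [u_3,u_4]=u_1-u_4$; * (15), (16), (17) $[u_2,u_3]=\varepsilon e_1+u_4,\ [u_3,u_4]=u_1$, with $\varepsilon=1,-1,0$ respectively; * (21), (22) $[u_2,u_3]=\varepsilon e_1,\ [u_3,u_4]=u_1$, with $\varepsilon=1,-1$ respectively. * $2.2^1$: $[e_1,e_2]=e_2,\ [e_1,u_1]=u_1,\ [e_1,u_3]=-u_3,\ [e_2,u_2]=u_1,\ [e_2,u_3]=-u_4$, together with * (2) $[u_1,u_2]=e_2,\ [u_1,u_3]=u_4,\ [u_2,u_3]=(p-1)u_3,\ [u_2,u_4]=pu_4$; * (3) $[u_2,u_3]=u_3,\ [u_2,u_4]=u_4$. * $2.5^1$: $[e_1,u_2]=u_1,\ [e_1,u_3]=-u_4,\ [e_2,u_3]=-u_2,\ [e_2,u_4]=u_1$, together with * (3) $[u_1,u_3]=u_1,\ [u_2,u_3]=e_1+re_2+(1-h)u_2,\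 [u_2,u_4]=hu_1,\ [u_3,u_4]=-(r+h)e_1+se_2-(1+h)u_4$, with $h\ge0$ if $s\ne0$; * (4) $[u_1,u_3]=u_1,\ [u_2,u_3]=re_2+(1-h)u_2,\ [u_2,u_4]=hu_1,\ [u_3,u_4]=-(r+h)e_1-(1+h)u_4$, $h\ge0$. * $2.5^2$: $[e_1,u_2]=u_1,\ [e_1,u_3]=-u_2,\ [e_2,u_3]=u_4,\ [e_2,u_4]=-u_1$, together with * (2) $[u_1,u_3]=u_1,\ [u_2,u_3]=(p+s)e_1+re_2+u_2-2ru_4,\ [u_2,u_4]=2ru_1,\ [u_3,u_4]=-re_1+(p-s)e_2-2ru_2-u_4$, $r,s\ge0$. * $3.3^1$: $[e_1,e_2]=-e_2,\ [e_1,e_3]=e_3,\ [e_1,u_2]=u_2,\ [e_1,u_4]=-u_4,\ [e_2,u_2]=u_1,\ [e_2,u_3]=-u_4,\ [e_3,u_3]=-u_2,\ [e_3,u_4]=u_1$, together with * (1) $[u_1,u_3]=u_1,\ [u_2,u_3]=pe_3+u_2,\ [u_3,u_4]=-pe_2-u_4$. * $3.3^2$: $[e_1,e_2]=-e_3,\ [e_1,e_3]=e_2,\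 [e_1,u_2]=u_4,\ [e_1,u_4]=-u_2,\ [e_2,u_2]=u_1,\ [e_2,u_3]=-u_2,\ [e_3,u_3]=u_4,\ [e_3,u_4]=-u_1$, together with * (1) $[u_1,u_3]=u_1,\ [u_2,u_3]=pe_2+u_2,\ [u_3,u_4]=pe_3-u_4$. The item $(q)$ of the family $n.m^k$ is denoted $n.m^k.q$. An *invariant metric* is a nondegenerate symmetric bilinear form $g$ on $\mathfrak m$ (of any signature) with $g([x,y]_{\mathfrak m},z)+g(y,[x,z]_{\mathfrak m})=0$ for $x\in\mathfrak h$, $y,z\in\mathfrak m$. Its Levi-Civita connection is $\Lambda:\mathfrak g\to\mathfrak{gl}(\mathfrak m)$, $\Lambda(x)y_{\mathfrak m}=\frac12[x,y]_{\mathfrak m}+v(x,y)$, where $2g(v(x,y),z_{\mathfrak m})=g(x_{\mathfrak m},[z,y]_{\mathfrak m})+g(y_{\mathfrak m},[z,x]_{\mathfrak m})$; its curvature is $R(x,y)=[\Lambda(x),\Lambda(y)]-\Lambda([x,y])$, and $\varrho(y,z)=\mathrm{tr}(x\mapsto R(x,y)z)$ is its Ricci tensor. A *non-trivial homogeneous Ricci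 soliton* is a triple $(g,X,\lambda)$ of an invariant metric $g$ that is not Einstein ($\varrho\ne\mu g$ for all $\mu\in\mathbb R$), a vector $X\in\mathfrak m$ and $\lambda\in\mathbb R$ with $\mathcal L_Xg+\varrho=\lambda g$, where $(\mathcal L_Xg)(y,z)=g([X,y]_{\mathfrak m},z)+g(y,[X,z]_{\mathfrak m})$. An *invariant almost complex structure* is an endomorphism $J$ of $\mathfrak m$ with $J^2=-1$ that commutes with $y\mapsto[x,y]_{\mathfrak m}$ for all $x\in\mathfrak h$; and $(g,J)$ is *(pseudo-)Kähler* if moreover $J$ has vanishing Nijenhuis tensor, $g(Jy,Jz)=g(y,z)$, and the invariant two-form $g(J\cdot,\cdot)$ is closed. Put $(\mathcal L_XJ)(y)=[X,Jy]_{\mathfrak m}-J[X,y]_{\mathfrak m}$; the field $X$ is *holomorphic* if $\mathcal L_XJ=0$. **Theorem.** Let $(g,X,\lambda)$ be a non-trivial homogeneous Ricci soliton on one of the pairs listed above. Then: 1. $g$ is not (pseudo-)Kähler: there is no invariant $J$ for which $(g,J)$ is (pseudo-)Kähler. In particular $(g,X,\lambda)$ is not a (pseudo-)Kähler–Ricci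 soliton. 2. For the pairs $1.1^2.1$, $1.1^2.6$ and $1.1^2.7$, the field $X$ is not holomorphic with respect to any invariant almost complex structure: $\mathcal L_XJ\ne0$ for every such $J$. -/

import Mathlib

noncomputable section

namespace HomSoliton

/-! ### The real Lie algebra pairs

A pair `(𝔤, 𝔥)` is described by a basis of `𝔤` indexed by `Fin n ⊕ Fin 4`: the first `n` vectors
`e₁, …, eₙ` span the isotropy subalgebra `𝔥`, and the last four, `u₁, …, u₄`, span the complement
`𝔪`, which represents the tangent space `𝔤 / 𝔥` of the homogeneous space. -/

abbrev PairIdx (n : ℕ) : Type := Fin n ⊕ Fin 4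

/-- The types of pairs `(𝔤, 𝔥)` in the list, with their real parameters; `tₙₘₖ_q` is the `q`-th pair
of type `n.mᵏ`, and the index `n` is the dimension of `𝔥`. -/
inductive PairType : ℕ → Type
  | t111_1 : PairType 1
  | t111_2 (p : ℝ) : PairType 1
  | t111_5 : PairType 1
  | t112_1 : PairType 1
  | t112_2 (p : ℝ) : PairType 1
  | t112_6 : PairType 1
  | t112_7 : PairType 1
  | t131_1 : PairType 1
  | t131_2 (p : ℝ) : PairType 1
  | t131_3 : PairType 1
  | t131_5 (p q : ℝ) : PairType 1
  | t131_6 : PairType 1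
  | t131_7 (p : ℝ) : PairType 1
  | t131_8 : PairType 1
  | t131_9 (p : ℝ) : PairType 1
  | t131_11 : PairType 1
  | t131_12 (p q : ℝ) : PairType 1
  | t131_13 (p : ℝ) : PairType 1
  | t131_14 (p : ℝ) : PairType 1
  | t131_19 : PairType 1
  | t131_20 : PairType 1
  | t131_21 (p : ℝ) : PairType 1
  | t131_22 : PairType 1
  | t131_28 : PairType 1
  | t141_2 (p : ℝ) : PairType 1
  | t141_9 (p r : ℝ) : PairType 1
  | t141_10 (p r : ℝ) : PairType 1
  | t141_11 (r : ℝ) : PairType 1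
  | t141_12 (r : ℝ) : PairType 1
  | t141_15 : PairType 1
  | t141_16 : PairType 1
  | t141_17 : PairType 1
  | t141_21 : PairType 1
  | t141_22 : PairType 1
  | t221_2 (p : ℝ) : PairType 2
  | t221_3 : PairType 2
  | t251_3 (h r s : ℝ) : PairType 2
  | t251_4 (h r : ℝ) : PairType 2
  | t252_2 (p r s : ℝ) : PairType 2
  | t331_1 (p : ℝ) : PairType 3
  | t332_1 (p : ℝ) : PairType 3

/-- The ranges of the parameters. -/
def PairType.Admissible : {n : ℕ} → PairType n → Prop
  | _, .t131_2 p => |p| ≤ 1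
  | _, .t131_5 p q => 0 ≤ p ∧ q ≠ 1
  | _, .t131_7 p => p ≠ -1
  | _, .t131_9 p => p ≠ 0
  | _, .t131_14 p => p ≠ 1 / 2
  | _, .t131_21 p => p ≠ 1
  | _, .t251_3 h _ s => s ≠ 0 → 0 ≤ h
  | _, .t251_4 h _ => 0 ≤ h
  | _, .t252_2 _ r s => 0 ≤ r ∧ 0 ≤ s
  | _, _ => True

/-- The three types `1.1².1`, `1.1².6` and `1.1².7`. -/
def PairType.IsCandidate : {n : ℕ} → PairType n → Prop
  | _, .t112_1 => True
  | _, .t112_6 => True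
  | _, .t112_7 => True
  | _, _ => False

section Table

variable {n : ℕ}

abbrev e1 [NeZero n] : PairIdx n := Sum.inl 0
abbrev e2 : PairIdx (n + 2) := Sum.inl 1
abbrev e3 : PairIdx (n + 3) := Sum.inl 2
abbrev u1 : PairIdx n := Sum.inr 0
abbrev u2 : PairIdx n := Sum.inr 1
abbrev u3 : PairIdx n := Sum.inr 2
abbrev u4 : PairIdx n := Sum.inr 3

/-- The coordinate vector of a basis element. -/
abbrev vec (i : PairIdx n) : PairIdx n → ℝ := Pi.single i 1

/-- An entry `(x, y, v)` stands for the bracket relation `[x, y] = v`. -/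
abbrev Rel (n : ℕ) : Type := PairIdx n × PairIdx n × (PairIdx n → ℝ)

/-- `1.1¹`: the brackets `[𝔥, 𝔤]`; likewise for the next lists. -/
def iso111 : List (Rel 1) := [(e1, u1, vec u1), (e1, u3, -vec u3)]

/-- `1.1²` -/
def iso112 : List (Rel 1) := [(e1, u1, vec u3), (e1, u3, -vec u1)]

/-- `1.3¹` -/
def iso131 : List (Rel 1) := [(e1, u3, vec u1), (e1, u4, vec u2)]

/-- `1.4¹` -/
def iso141 : List (Rel 1) := [(e1, u2, vec u1), (e1, u3, vec u2)]

/-- `2.2¹` -/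
def iso221 : List (Rel 2) :=
  [(e1, e2, vec e2), (e1, u1, vec u1), (e1, u3, -vec u3), (e2, u2, vec u1), (e2, u3, -vec u4)]

/-- `2.5¹` -/
def iso251 : List (Rel 2) :=
  [(e1, u2, vec u1), (e1, u3, -vec u4), (e2, u3, -vec u2), (e2, u4, vec u1)]

/-- `2.5²` -/
def iso252 : List (Rel 2) :=
  [(e1, u2, vec u1), (e1, u3, -vec u2), (e2, u3, vec u4), (e2, u4, -vec u1)]

/-- `3.3¹` -/
def iso331 : List (Rel 3) :=
  [(e1, e2, -vec e2), (e1, e3, vec e3),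
    (e1, u2, vec u2), (e1, u4, -vec u4), (e2, u2, vec u1), (e2, u3, -vec u4),
    (e3, u3, -vec u2), (e3, u4, vec u1)]

/-- `3.3²` -/
def iso332 : List (Rel 3) :=
  [(e1, e2, -vec e3), (e1, e3, vec e2),
    (e1, u2, vec u4), (e1, u4, -vec u2), (e2, u2, vec u1), (e2, u3, -vec u2),
    (e3, u3, vec u4), (e3, u4, -vec u1)]

/-- The non-vanishing brackets of the basis vectors. In the non-reductive pairs `1.3¹.1` and `1.4¹.2`
there is also a bracket of `e₁` with a vector of `𝔪` that has a component in `𝔥`. -/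
def PairType.table : {n : ℕ} → PairType n → List (Rel n)
  | _, .t111_1 => iso111 ++ [(u1, u3, vec u2), (u2, u4, vec u2), (u3, u4, vec u3)]
  | _, .t111_2 p => iso111 ++ [(u2, u4, p • vec u2), (u3, u4, vec u3)]
  | _, .t111_5 => iso111 ++ [(u1, u3, vec e1), (u2, u4, vec u2)]
  | _, .t112_1 => iso112 ++
      [(u1, u3, -vec u2), (u1, u4, vec u1), (u2, u4, (2 : ℝ) • vec u2), (u3, u4, vec u3)]
  | _, .t112_2 p => iso112 ++ [(u1, u4, vec u1), (u2, u4, p • vec u2), (u3, u4, vec u3)]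
  | _, .t112_6 => iso112 ++ [(u1, u3, vec e1), (u2, u4, vec u2)]
  | _, .t112_7 => iso112 ++ [(u1, u3, -vec e1), (u2, u4, vec u2)]
  | _, .t131_1 => iso131 ++
      [(e1, u1, vec e1), (u1, u2, (-1 / 2 : ℝ) • vec u2), (u1, u3, vec u3),
        (u1, u4, (1 / 2 : ℝ) • vec u4), (u2, u3, (1 / 2 : ℝ) • vec u4)]
  | _, .t131_2 p => iso131 ++
      [(u1, u3, -p • vec e1 + (p + 1) • vec u1 + p • vec u2), (u2, u4, vec u2)]
  | _, .t131_3 => iso131 ++ [(u1, u3, vec u1), (u2, u4, vec u2), (u3, u4, vec e1)]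
  | _, .t131_5 p q => iso131 ++
      [(u1, u3, -((p ^ 2 + q) / (q - 1)) • vec e1 + ((1 + p ^ 2) / (q - 1)) • vec u2),
        (u1, u4, -p • vec e1 + vec u1 + p • vec u2),
        (u2, u3, -p • vec e1 + vec u1 + p • vec u2),
        (u2, u4, -q • vec e1 + (q + 1) • vec u2)]
  | _, .t131_6 => iso131 ++
      [(u1, u3, -vec u2), (u1, u4, vec u1), (u2, u3, vec u1), (u2, u4, vec u2), (u3, u4, vec e1)]
  | _, .t131_7 p => iso131 ++
      [(u1, u3, (1 / (1 + p)) • vec e1 + (p / (1 + p)) • vec u1 - (1 / (1 + p)) • vec u2),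
        (u1, u4, -(1 / (1 + p)) • vec e1 + (1 / (1 + p)) • vec u1 + (1 / (1 + p)) • vec u2),
        (u2, u3, -(1 / (1 + p)) • vec e1 + (1 / (1 + p)) • vec u1 + (1 / (1 + p)) • vec u2),
        (u2, u4, -(p / (1 + p)) • vec e1 + (p / (1 + p)) • vec u1
          + ((1 + 2 * p) / (1 + p)) • vec u2)]
  | _, .t131_8 => iso131 ++ [(u2, u3, vec u1), (u2, u4, vec u2), (u3, u4, -vec u3)]
  | _, .t131_9 p => iso131 ++
      [(u2, u3, p • vec u1), (u2, u4, -p • vec e1 + (p + 1) • vec u2), (u3, u4, -p • vec u3)]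
  | _, .t131_11 => iso131 ++ [(u2, u3, -vec u1), (u2, u4, vec e1), (u3, u4, vec e1 + vec u3)]
  | _, .t131_12 p q => iso131 ++
      [(u1, u4, vec u1), (u2, u3, q • vec u1), (u2, u4, -(p * q) • vec e1 + (p + q) • vec u2),
        (u3, u4, (1 - q) • vec u3)]
  | _, .t131_13 p => iso131 ++
      [(u1, u4, vec u1), (u2, u3, (1 / 2 : ℝ) • vec u1),
        (u2, u4, -(p / 2) • vec e1 + (p + 1 / 2) • vec u2),
        (u3, u4, vec e1 + (1 / 2 : ℝ) • vec u3)]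
  | _, .t131_14 p => iso131 ++
      [(u1, u4, vec u1), (u2, u3, (1 - p) • vec u1), (u2, u4, (p * (p - 1)) • vec e1 + vec u2),
        (u3, u4, vec e1 + p • vec u3)]
  | _, .t131_19 => iso131 ++
      [(u1, u4, vec u1), (u2, u3, vec u1), (u2, u4, -vec e1 + vec u1 + (2 : ℝ) • vec u2)]
  | _, .t131_20 => iso131 ++
      [(u2, u3, vec u1), (u2, u4, -vec u1 + vec u2), (u3, u4, -vec u3)]
  | _, .t131_21 p => iso131 ++
      [(u1, u4, vec u1), (u2, u3, p • vec u1),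
        (u2, u4, -p • vec e1 + (1 - p) • vec u1 + (1 + p) • vec u2),
        (u3, u4, (1 - p) • vec u3)]
  | _, .t131_22 => iso131 ++
      [(u1, u4, vec u1), (u2, u3, (1 / 2 : ℝ) • vec u1),
        (u2, u4, (-1 / 2 : ℝ) • vec e1 + (1 / 2 : ℝ) • vec u1 + (3 / 2 : ℝ) • vec u2),
        (u3, u4, vec e1 + (1 / 2 : ℝ) • vec u3)]
  | _, .t131_28 => iso131 ++
      [(u1, u3, (2 : ℝ) • vec u1), (u1, u4, (2 : ℝ) • vec u2), (u2, u3, vec u2),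
        (u2, u4, vec e1 - (1 / 2 : ℝ) • vec u1), (u3, u4, vec u4)]
  | _, .t141_2 p => iso141 ++
      [(e1, u4, vec e1), (u1, u4, p • vec u1), (u2, u4, (p - 1) • vec u2),
        (u3, u4, (p - 2) • vec u3)]
  | _, .t141_9 p r => iso141 ++
      [(u1, u3, vec u1), (u2, u3, r • vec e1 + vec u2 + vec u4), (u3, u4, p • vec u4)]
  | _, .t141_10 p r => iso141 ++
      [(u1, u3, vec u1), (u2, u3, r • vec e1 + vec u2), (u3, u4, p • vec u4)]
  | _, .t141_11 r => iso141 ++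
      [(u1, u3, vec u1), (u2, u3, r • vec e1 + vec u2 + vec u4), (u3, u4, vec u1 - vec u4)]
  | _, .t141_12 r => iso141 ++
      [(u1, u3, vec u1), (u2, u3, r • vec e1 + vec u2), (u3, u4, vec u1 - vec u4)]
  | _, .t141_15 => iso141 ++ [(u2, u3, vec e1 + vec u4), (u3, u4, vec u1)]
  | _, .t141_16 => iso141 ++ [(u2, u3, -vec e1 + vec u4), (u3, u4, vec u1)]
  | _, .t141_17 => iso141 ++ [(u2, u3, vec u4), (u3, u4, vec u1)]
  | _, .t141_21 => iso141 ++ [(u2, u3, vec e1), (u3, u4, vec u1)]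
  | _, .t141_22 => iso141 ++ [(u2, u3, -vec e1), (u3, u4, vec u1)]
  | _, .t221_2 p => iso221 ++
      [(u1, u2, vec e2), (u1, u3, vec u4), (u2, u3, (p - 1) • vec u3), (u2, u4, p • vec u4)]
  | _, .t221_3 => iso221 ++ [(u2, u3, vec u3), (u2, u4, vec u4)]
  | _, .t251_3 h r s => iso251 ++
      [(u1, u3, vec u1), (u2, u3, vec e1 + r • vec e2 + (1 - h) • vec u2), (u2, u4, h • vec u1),
        (u3, u4, -(r + h) • vec e1 + s • vec e2 - (1 + h) • vec u4)]
  | _, .t251_4 h r => iso251 ++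
      [(u1, u3, vec u1), (u2, u3, r • vec e2 + (1 - h) • vec u2), (u2, u4, h • vec u1),
        (u3, u4, -(r + h) • vec e1 - (1 + h) • vec u4)]
  | _, .t252_2 p r s => iso252 ++
      [(u1, u3, vec u1),
        (u2, u3, (p + s) • vec e1 + r • vec e2 + vec u2 - (2 * r) • vec u4),
        (u2, u4, (2 * r) • vec u1),
        (u3, u4, -r • vec e1 + (p - s) • vec e2 - (2 * r) • vec u2 - vec u4)]
  | _, .t331_1 p => iso331 ++
      [(u1, u3, vec u1), (u2, u3, p • vec e3 + vec u2), (u3, u4, -p • vec e2 - vec u4)]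
  | _, .t332_1 p => iso332 ++
      [(u1, u3, vec u1), (u2, u3, p • vec e2 + vec u2), (u3, u4, p • vec e3 - vec u4)]

/-- The coordinates of the bracket of two basis vectors: read off the table, extended by
skew-symmetry, and zero for the pairs that are not listed. -/
def PairType.bracket (t : PairType n) (i j : PairIdx n) : PairIdx n → ℝ :=
  (t.table.map fun r : Rel n =>
    if i = r.1 ∧ j = r.2.1 then r.2.2 else if i = r.2.1 ∧ j = r.1 then -r.2.2 else 0).sum

end Table

/-! ### Invariant geometry of a pair

Everything below is for a real Lie algebra `𝔤` with a basis `B = (e₁, …, eₙ, u₁, …, u₄)`. Vectors of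
`𝔪 ≃ 𝔤 / 𝔥` are written in the coordinates with respect to `u₁, …, u₄`, that is, in `Fin 4 → ℝ`;
bilinear forms on `𝔪` and endomorphisms of `𝔪` are their `4 × 4` matrices in this basis. -/

section Geometry

variable {n : ℕ} {𝔤 : Type*} [LieRing 𝔤] [LieAlgebra ℝ 𝔤]

/-- `B` is a basis of `𝔤` in which the brackets are those of the pair `t`. -/
def IsAdaptedBasis (t : PairType n) (B : Module.Basis (PairIdx n) ℝ 𝔤) : Prop :=
  ∀ i j, ⁅B i, B j⁆ = ∑ k, t.bracket i j k • B k

variable (B : Module.Basis (PairIdx n) ℝ 𝔤)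

/-- The component `x_𝔪` of `x ∈ 𝔤 = 𝔥 ⊕ 𝔪`. -/
def mPart (x : 𝔤) : Fin 4 → ℝ := fun k => B.repr x (Sum.inr k)

/-- The element `∑ yₖ uₖ` of `𝔪 ⊆ 𝔤`. -/
def mVec (y : Fin 4 → ℝ) : 𝔤 := ∑ k, y k • B (Sum.inr k)

/-- The matrix of `y ↦ [x, y]_𝔪` on `𝔪`, for `x ∈ 𝔤`. For `x ∈ 𝔥` this is the isotropy
representation `ψ(x)`. -/
def adMat (x : 𝔤) : Matrix (Fin 4) (Fin 4) ℝ :=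
  Matrix.of fun i j => mPart B ⁅x, B (Sum.inr j)⁆ i

/-- The bilinear form with matrix `G`. -/
def form (G : Matrix (Fin 4) (Fin 4) ℝ) (y z : Fin 4 → ℝ) : ℝ := y ⬝ᵥ (G.mulVec z)

/-- Invariant pseudo-Riemannian metrics: the symmetric nondegenerate bilinear forms `g` on `𝔪` with
`ψ(x)ᵗ ∘ g + g ∘ ψ(x) = 0` for all `x ∈ 𝔥`. No condition is imposed on the signature. -/
structure IsInvariantMetric (G : Matrix (Fin 4) (Fin 4) ℝ) : Prop where
  symm : G.IsSymm
  nondeg : G.det ≠ 0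
  invariant : ∀ i : Fin n, (adMat B (B (Sum.inl i))).transpose * G + G * adMat B (B (Sum.inl i)) = 0

/-- The vector `v(x, y) ∈ 𝔪` with
`2 g(v(x, y), z) = g(x_𝔪, [z, y]_𝔪) + g(y_𝔪, [z, x]_𝔪)` for all `z ∈ 𝔪`. -/
def symPart (G : Matrix (Fin 4) (Fin 4) ℝ) (x y : 𝔤) : Fin 4 → ℝ :=
  G⁻¹.mulVec fun k =>
    (1 / 2) * (form G (mPart B x) (mPart B ⁅B (Sum.inr k), y⁆)
      + form G (mPart B y) (mPart B ⁅B (Sum.inr k), x⁆))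

/-- The Levi-Civita connection `Λ : 𝔤 → 𝔤𝔩(𝔪)`, `Λ(x)(y_𝔪) = ½ [x, y]_𝔪 + v(x, y)`. -/
def leviCivita (G : Matrix (Fin 4) (Fin 4) ℝ) (x : 𝔤) : Matrix (Fin 4) (Fin 4) ℝ :=
  Matrix.of fun i j =>
    (1 / 2) * mPart B ⁅x, B (Sum.inr j)⁆ i + symPart B G x (B (Sum.inr j)) i

/-- The curvature `R(x, y) = [Λ(x), Λ(y)] - Λ([x, y])`. -/
def curvature (G : Matrix (Fin 4) (Fin 4) ℝ) (x y : 𝔤) : Matrix (Fin 4) (Fin 4) ℝ :=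
  leviCivita B G x * leviCivita B G y - leviCivita B G y * leviCivita B G x
    - leviCivita B G ⁅x, y⁆

/-- The Ricci tensor: `ϱ(uᵢ, uⱼ)` is the trace of `x ↦ R(x, uᵢ) uⱼ`. -/
def ricci (G : Matrix (Fin 4) (Fin 4) ℝ) : Matrix (Fin 4) (Fin 4) ℝ :=
  Matrix.of fun i j => ∑ r, curvature B G (B (Sum.inr r)) (B (Sum.inr i)) r j

/-- The metric is Einstein: `ϱ = μ g` for a real constant `μ`. -/
def IsEinstein (G : Matrix (Fin 4) (Fin 4) ℝ) : Prop := ∃ μ : ℝ, ricci B G = μ • G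

/-- The form with entries `g([X, uᵢ]_𝔪, uⱼ) + g(uᵢ, [X, uⱼ]_𝔪)`, for `X ∈ 𝔪`. It represents `ℒ_X g`,
up to the sign of `X`, which plays no role as `X` and `-X` both range over `𝔪`. -/
def lieDerivMetric (G : Matrix (Fin 4) (Fin 4) ℝ) (X : Fin 4 → ℝ) : Matrix (Fin 4) (Fin 4) ℝ :=
  (adMat B (mVec B X)).transpose * G + G * adMat B (mVec B X)

/-- The Ricci soliton equation `ℒ_X g + ϱ = lam g`. -/
def IsRicciSoliton (G : Matrix (Fin 4) (Fin 4) ℝ) (X : Fin 4 → ℝ) (lam : ℝ) : Prop :=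
  lieDerivMetric B G X + ricci B G = lam • G

/-- Invariant almost complex structures: `J² = -1`, and `J` commutes with the isotropy
representation. -/
structure IsInvariantAlmostComplex (J : Matrix (Fin 4) (Fin 4) ℝ) : Prop where
  sq : J * J = -1
  invariant : ∀ i : Fin n, adMat B (B (Sum.inl i)) * J = J * adMat B (B (Sum.inl i))

/-- The bracket `[y, z]_𝔪` of two vectors of `𝔪`. -/
def mBracket (y z : Fin 4 → ℝ) : Fin 4 → ℝ := mPart B ⁅mVec B y, mVec B z⁆

/-- The Nijenhuis tensor `[Jy, Jz] - J[Jy, z] - J[y, Jz] - [y, z]` vanishes. -/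
def IsIntegrable (J : Matrix (Fin 4) (Fin 4) ℝ) : Prop :=
  ∀ y z : Fin 4 → ℝ,
    mBracket B (J.mulVec y) (J.mulVec z) - J.mulVec (mBracket B (J.mulVec y) z)
      - J.mulVec (mBracket B y (J.mulVec z)) - mBracket B y z = 0

/-- The fundamental two-form `Ω(y, z) = g(Jy, z)`. -/
def kahlerForm (G J : Matrix (Fin 4) (Fin 4) ℝ) (y z : Fin 4 → ℝ) : ℝ := form G (J.mulVec y) z

/-- `dΩ = 0`, where
`dΩ(x, y, z) = -(Ω([x, y]_𝔪, z) + Ω([y, z]_𝔪, x) + Ω([z, x]_𝔪, y))`. -/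
def IsKahlerFormClosed (G J : Matrix (Fin 4) (Fin 4) ℝ) : Prop :=
  ∀ x y z : Fin 4 → ℝ,
    kahlerForm G J (mBracket B x y) z + kahlerForm G J (mBracket B y z) x
      + kahlerForm G J (mBracket B z x) y = 0

/-- `(g, J)` is an invariant (pseudo-)Kähler structure: `J` is an invariant complex structure, `g` is
Hermitian with respect to `J`, and the fundamental form is closed. -/
structure IsPseudoKahler (G J : Matrix (Fin 4) (Fin 4) ℝ) : Prop where
  almostComplex : IsInvariantAlmostComplex B J
  integrable : IsIntegrable B J
  hermitian : ∀ y z : Fin 4 → ℝ, form G (J.mulVec y) (J.mulVec z) = form G y z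
  closed : IsKahlerFormClosed B G J

/-- `(ℒ_X J)(y) = [X, Jy]_𝔪 - J[X, y]_𝔪`, for `X ∈ 𝔪`; the field `X` is holomorphic when this
vanishes. -/
def lieDerivComplex (X : Fin 4 → ℝ) (J : Matrix (Fin 4) (Fin 4) ℝ) : Matrix (Fin 4) (Fin 4) ℝ :=
  adMat B (mVec B X) * J - J * adMat B (mVec B X)

end Geometry

end HomSoliton

end

/-! The aim is to show that a pseudo-Kähler soliton on a listed pair is Einstein, which contradicts
non-triviality. Since `J` commutes with the isotropy operators, the isotropy decides most cases. For
1.1¹, 1.4¹, 2.2¹, 2.5ᵏ and 3.3ᵏ, a polynomial in the isotropy operators is a multiple of a matrix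
unit. An operator commuting with it has a real eigenvector, so no invariant `J` exists
(`not_commute_single`). For 1.3¹ and 1.1², linear algebra puts `G` and `J` in normal forms with few
parameters (`exists_metric_of_shift`, `exists_complex_of_shift` and their analogues for `rotation`).
On 1.3¹, well-chosen components of dΩ = 0 and of the Nijenhuis tensor are contradictory, except for
1.3¹.1, 1.3¹.5 and 1.3¹.12, where they restrict the metric or the parameters so far that the Ricci
tensor vanishes. On 1.1², the pair 1.1².2 has no closed Ω. On 1.1².1 the Kähler conditions fix the
determinant of the metric on span(u₂, u₄), and the metric is Einstein. On 1.1².6 and 1.1².7 that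
plane is definite, and the soliton equation makes y ↦ [X, y]_𝔪 vanish. Whenever this map vanishes,
ℒ_X g = 0 and the soliton equation is the Einstein equation. This also gives the second claim: on
the three candidates a holomorphic X acts on span(u₂, u₄) by a singular map commuting with a complex
structure, so by zero there, and then by zero on all of 𝔪. -/

namespace HomSoliton

section General

variable {n : ℕ} {𝔤 : Type*} [LieRing 𝔤] [LieAlgebra ℝ 𝔤] {t : PairType n}
  {B : Module.Basis (PairIdx n) ℝ 𝔤}

/-! ### Coordinate formulas -/

theorem mPart_add (x y : 𝔤) : mPart B (x + y) = mPart B x + mPart B y := by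
  ext k; simp [mPart]

theorem mPart_smul (c : ℝ) (x : 𝔤) : mPart B (c • x) = c • mPart B x := by
  ext k; simp [mPart]

theorem mPart_sum {ι : Type*} (s : Finset ι) (f : ι → 𝔤) :
    mPart B (∑ i ∈ s, f i) = ∑ i ∈ s, mPart B (f i) := by
  ext k; simp [mPart, Finset.sum_apply, Finsupp.finsetSum_apply]

theorem mPart_basis_inr (j : Fin 4) : mPart B (B (Sum.inr j)) = Pi.single j 1 := by
  ext k
  simp [mPart, Finsupp.single_apply, Pi.single_apply, eq_comm]

theorem mPart_basis_inl (j : Fin n) : mPart B (B (Sum.inl j)) = 0 := by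
  ext k; simp [mPart]

theorem IsAdaptedBasis.repr_lie (hB : IsAdaptedBasis t B) (i j k : PairIdx n) :
    B.repr ⁅B i, B j⁆ k = t.bracket i j k := by
  rw [hB, B.repr_sum_self]

theorem IsAdaptedBasis.mPart_lie (hB : IsAdaptedBasis t B) (i j : PairIdx n) :
    mPart B ⁅B i, B j⁆ = fun k => t.bracket i j (Sum.inr k) :=
  funext fun k => hB.repr_lie i j (Sum.inr k)

theorem IsAdaptedBasis.adMat_basis (hB : IsAdaptedBasis t B) (x : PairIdx n) :
    adMat B (B x) = Matrix.of fun i j => t.bracket x (Sum.inr j) (Sum.inr i) := by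
  ext i j
  simp [adMat, hB.mPart_lie]

theorem IsAdaptedBasis.mBracket_eq (hB : IsAdaptedBasis t B) (y z : Fin 4 → ℝ) (k : Fin 4) :
    mBracket B y z k =
      ∑ i, ∑ j, y i * z j * t.bracket (Sum.inr i) (Sum.inr j) (Sum.inr k) := by
  simp only [mBracket, mVec, sum_lie, lie_sum, smul_lie, lie_smul, mPart_sum, mPart_smul,
    hB.mPart_lie, Finset.sum_apply, Pi.smul_apply, smul_eq_mul, mul_assoc, Finset.mul_sum]
  rw [Finset.sum_comm]
  exact Finset.sum_congr rfl fun _ _ => Finset.sum_congr rfl fun _ _ => mul_left_comm _ _ _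

theorem mVec_single (i : Fin 4) : mVec B (Pi.single i 1) = B (Sum.inr i) := by
  simp [mVec, Pi.single_apply]

theorem adMat_mVec (X : Fin 4 → ℝ) (i j : Fin 4) :
    adMat B (mVec B X) i j = mBracket B X (Pi.single j 1) i := by
  rw [mBracket, mVec_single]; rfl

/-! ### Complex structures commuting with an operator of rank one -/

/-- A commuting `J` preserves the image of the matrix unit, a real line, so it has a real
eigenvalue, whose square cannot be -1. -/
theorem not_commute_single {J : Matrix (Fin 4) (Fin 4) ℝ} (hJ : J * J = -1) (i j : Fin 4) {x : ℝ}
    (hx : x ≠ 0) : Matrix.single i j x * J ≠ J * Matrix.single i j x := by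
  intro h
  have h0 : ∀ k, k ≠ i → J k i = 0 := by
    intro k hk
    have := congrFun (congrFun h k) j
    rw [Matrix.single_mul_apply_of_ne _ _ _ _ _ hk, Matrix.mul_single_apply_same] at this
    exact (mul_eq_zero.1 this.symm).resolve_right hx
  have h1 := congrFun (congrFun hJ i) i
  rw [Matrix.mul_apply, Finset.sum_eq_single i (fun k _ hk => by rw [h0 k hk, mul_zero])
    (fun h => absurd (Finset.mem_univ i) h)] at h1
  simp only [Matrix.neg_apply, Matrix.one_apply_eq] at h1
  nlinarith [mul_self_nonneg (J i i)]

theorem IsInvariantAlmostComplex.commute {J : Matrix (Fin 4) (Fin 4) ℝ}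
    (h : IsInvariantAlmostComplex B J) (i : Fin n) : Commute (adMat B (B (Sum.inl i))) J :=
  h.invariant i

/-! ### The Ricci tensor from the connection coefficients -/

theorem form_add_left (G : Matrix (Fin 4) (Fin 4) ℝ) (y y' z : Fin 4 → ℝ) :
    form G (y + y') z = form G y z + form G y' z := by
  simp [form, add_dotProduct]

theorem form_add_right (G : Matrix (Fin 4) (Fin 4) ℝ) (y z z' : Fin 4 → ℝ) :
    form G y (z + z') = form G y z + form G y z' := by
  simp [form, Matrix.mulVec_add]

theorem form_smul_left (G : Matrix (Fin 4) (Fin 4) ℝ) (c : ℝ) (y z : Fin 4 → ℝ) :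
    form G (c • y) z = c * form G y z := by
  simp [form]

theorem form_smul_right (G : Matrix (Fin 4) (Fin 4) ℝ) (c : ℝ) (y z : Fin 4 → ℝ) :
    form G y (c • z) = c * form G y z := by
  simp [form, Matrix.mulVec_smul]

theorem symPart_add_left (G : Matrix (Fin 4) (Fin 4) ℝ) (x x' y : 𝔤) :
    symPart B G (x + x') y = symPart B G x y + symPart B G x' y := by
  rw [symPart, symPart, symPart, ← Matrix.mulVec_add]
  congr 1
  ext k
  simp only [mPart_add, lie_add, form_add_left, form_add_right, Pi.add_apply]
  ring

theorem symPart_smul_left (G : Matrix (Fin 4) (Fin 4) ℝ) (c : ℝ) (x y : 𝔤) :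
    symPart B G (c • x) y = c • symPart B G x y := by
  rw [symPart, symPart, ← Matrix.mulVec_smul]
  congr 1
  ext k
  simp only [mPart_smul, lie_smul, form_smul_left, form_smul_right, Pi.smul_apply, smul_eq_mul]
  ring

/-- The Levi-Civita connection as a linear map. -/
noncomputable def leviCivitaLin (B : Module.Basis (PairIdx n) ℝ 𝔤) (G : Matrix (Fin 4) (Fin 4) ℝ) :
    𝔤 →ₗ[ℝ] Matrix (Fin 4) (Fin 4) ℝ where
  toFun := leviCivita B G
  map_add' x y := by
    ext i j
    simp only [leviCivita, Matrix.of_apply, Matrix.add_apply, add_lie, mPart_add, symPart_add_left,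
      Pi.add_apply]
    ring
  map_smul' c x := by
    ext i j
    simp only [leviCivita, Matrix.of_apply, Matrix.smul_apply, smul_lie, mPart_smul,
      symPart_smul_left, Pi.smul_apply, smul_eq_mul, RingHom.id_apply]
    ring

/-- The sum includes the vectors of 𝔥: [uᵢ, uⱼ] can have an 𝔥-component, which contributes to the
curvature through the isotropy. -/
theorem IsAdaptedBasis.leviCivita_lie (hB : IsAdaptedBasis t B) (G : Matrix (Fin 4) (Fin 4) ℝ)
    (i j : PairIdx n) :
    leviCivita B G ⁅B i, B j⁆ = ∑ k, t.bracket i j k • leviCivita B G (B k) := by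
  change leviCivitaLin B G _ = ∑ k, t.bracket i j k • leviCivitaLin B G (B k)
  rw [hB, map_sum]
  simp

theorem form_single_left (G : Matrix (Fin 4) (Fin 4) ℝ) (i : Fin 4) (z : Fin 4 → ℝ) :
    form G (Pi.single i 1) z = ∑ m, G i m * z m := by
  rw [form, single_one_dotProduct]
  rfl

theorem form_zero_left (G : Matrix (Fin 4) (Fin 4) ℝ) (z : Fin 4 → ℝ) : form G 0 z = 0 := by
  simp [form]

/-- The Koszul formula characterizes the connection coefficients. -/
theorem leviCivita_eq_of_koszul {G : Matrix (Fin 4) (Fin 4) ℝ} (hG : G.det ≠ 0) (x : 𝔤)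
    (M : Matrix (Fin 4) (Fin 4) ℝ)
    (h : ∀ k j, 2 * ∑ m, G k m * M m j = ∑ m, G k m * mPart B ⁅x, B (Sum.inr j)⁆ m
      + form G (mPart B x) (mPart B ⁅B (Sum.inr k), B (Sum.inr j)⁆)
      + ∑ m, G j m * mPart B ⁅B (Sum.inr k), x⁆ m) :
    leviCivita B G x = M := by
  ext i j
  -- The hypothesis says that `G` maps this vector to the covector defining `symPart`, so `G⁻¹`
  -- cancels and never has to be computed.
  have key : symPart B G x (B (Sum.inr j))
      = fun i => M i j - (1 / 2) * mPart B ⁅x, B (Sum.inr j)⁆ i := by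
    have : (fun k => (1 / 2) * (form G (mPart B x) (mPart B ⁅B (Sum.inr k), B (Sum.inr j)⁆)
        + form G (mPart B (B (Sum.inr j))) (mPart B ⁅B (Sum.inr k), x⁆)))
        = G.mulVec (fun i => M i j - (1 / 2) * mPart B ⁅x, B (Sum.inr j)⁆ i) := by
      ext k
      have h' := h k j
      simp only [Fin.sum_univ_four] at h'
      rw [mPart_basis_inr, form_single_left]
      simp only [Matrix.mulVec, dotProduct, Fin.sum_univ_four]
      linarith
    rw [symPart, this, Matrix.mulVec_mulVec, Matrix.nonsing_inv_mul _ (isUnit_iff_ne_zero.2 hG),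
      Matrix.one_mulVec]
  simp only [leviCivita, Matrix.of_apply, key]
  ring

/-- A certificate: an explicit candidate for Λ(uᵢ) is confirmed by sixteen scalar identities in the
structure constants. -/
theorem IsAdaptedBasis.leviCivita_inr (hB : IsAdaptedBasis t B) {G : Matrix (Fin 4) (Fin 4) ℝ}
    (hG : G.det ≠ 0) (i : Fin 4) (M : Matrix (Fin 4) (Fin 4) ℝ)
    (h : ∀ k j, 2 * ∑ m, G k m * M m j =
      ∑ m, G k m * t.bracket (Sum.inr i) (Sum.inr j) (Sum.inr m)
      + ∑ m, G i m * t.bracket (Sum.inr k) (Sum.inr j) (Sum.inr m)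
      + ∑ m, G j m * t.bracket (Sum.inr k) (Sum.inr i) (Sum.inr m)) :
    leviCivita B G (B (Sum.inr i)) = M := by
  apply leviCivita_eq_of_koszul hG
  intro k j
  rw [h k j, mPart_basis_inr, form_single_left]
  simp only [hB.mPart_lie]

theorem IsAdaptedBasis.leviCivita_inl (hB : IsAdaptedBasis t B) {G : Matrix (Fin 4) (Fin 4) ℝ}
    (hG : G.det ≠ 0) (i : Fin n) (M : Matrix (Fin 4) (Fin 4) ℝ)
    (h : ∀ k j, 2 * ∑ m, G k m * M m j =
      ∑ m, G k m * t.bracket (Sum.inl i) (Sum.inr j) (Sum.inr m)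
      + ∑ m, G j m * t.bracket (Sum.inr k) (Sum.inl i) (Sum.inr m)) :
    leviCivita B G (B (Sum.inl i)) = M := by
  apply leviCivita_eq_of_koszul hG
  intro k j
  rw [h k j, mPart_basis_inl, form_zero_left]
  simp only [hB.mPart_lie, add_zero]

theorem IsAdaptedBasis.ricci_apply (hB : IsAdaptedBasis t B) (G : Matrix (Fin 4) (Fin 4) ℝ)
    (i j : Fin 4) :
    ricci B G i j = ∑ r, (∑ m, (leviCivita B G (B (Sum.inr r)) r m
        * leviCivita B G (B (Sum.inr i)) m j
      - leviCivita B G (B (Sum.inr i)) r m * leviCivita B G (B (Sum.inr r)) m j)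
      - ∑ k, t.bracket (Sum.inr r) (Sum.inr i) k * leviCivita B G (B k) r j) := by
  simp only [ricci, Matrix.of_apply, curvature, hB.leviCivita_lie, Matrix.sub_apply,
    Matrix.mul_apply, Finset.sum_sub_distrib, Matrix.sum_apply, Matrix.smul_apply, smul_eq_mul]

end General

section Isotropy

/-! ### The isotropy representations -/

/-- The bracket of two basis vectors, entry by entry. -/
theorem PairType.bracket_apply {n : ℕ} (t : PairType n) (i j k : PairIdx n) :
    t.bracket i j k = (t.table.map fun r : Rel n =>
      if i = r.1 ∧ j = r.2.1 then r.2.2 k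
        else if i = r.2.1 ∧ j = r.1 then -r.2.2 k else 0).sum := by
  unfold PairType.bracket
  induction t.table with
  | nil => rfl
  | cons r l ih =>
    simp only [List.map_cons, List.sum_cons, Pi.add_apply, ih]
    congr 1
    split_ifs <;> rfl

/-- The isotropy operator of the pairs of type `1.1¹`. -/
abbrev boost : Matrix (Fin 4) (Fin 4) ℝ := !![1, 0, 0, 0; 0, 0, 0, 0; 0, 0, -1, 0; 0, 0, 0, 0]

/-- The isotropy operator `u₁ ↦ u₃`, `u₃ ↦ -u₁` of the pairs of type `1.1²`. -/
abbrev rotation : Matrix (Fin 4) (Fin 4) ℝ := !![0, 0, -1, 0; 0, 0, 0, 0; 1, 0, 0, 0; 0, 0, 0, 0]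

/-- The isotropy operator `u₃ ↦ u₁`, `u₄ ↦ u₂` of the pairs of type `1.3¹`. -/
abbrev shift : Matrix (Fin 4) (Fin 4) ℝ := !![0, 0, 1, 0; 0, 0, 0, 1; 0, 0, 0, 0; 0, 0, 0, 0]

/-- The isotropy operator `u₃ ↦ u₂ ↦ u₁` of the pairs of type `1.4¹`. -/
abbrev nullRotation : Matrix (Fin 4) (Fin 4) ℝ :=
  !![0, 1, 0, 0; 0, 0, 1, 0; 0, 0, 0, 0; 0, 0, 0, 0]

/-- The matrices of the isotropy representation in the basis `u₁, …, u₄`. -/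
def PairType.isotropy : {n : ℕ} → PairType n → Fin n → Matrix (Fin 4) (Fin 4) ℝ
  | _, .t111_1 | _, .t111_2 _ | _, .t111_5 => ![boost]
  | _, .t112_1 | _, .t112_2 _ | _, .t112_6 | _, .t112_7 => ![rotation]
  | _, .t131_1 | _, .t131_2 _ | _, .t131_3 | _, .t131_5 _ _ | _, .t131_6 | _, .t131_7 _
  | _, .t131_8 | _, .t131_9 _ | _, .t131_11 | _, .t131_12 _ _ | _, .t131_13 _ | _, .t131_14 _
  | _, .t131_19 | _, .t131_20 | _, .t131_21 _ | _, .t131_22 | _, .t131_28 => ![shift]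
  | _, .t141_2 _ | _, .t141_9 _ _ | _, .t141_10 _ _ | _, .t141_11 _ | _, .t141_12 _
  | _, .t141_15 | _, .t141_16 | _, .t141_17 | _, .t141_21 | _, .t141_22 => ![nullRotation]
  | _, .t221_2 _ | _, .t221_3 =>
      ![boost, !![0, 1, 0, 0; 0, 0, 0, 0; 0, 0, 0, 0; 0, 0, -1, 0]]
  | _, .t251_3 _ _ _ | _, .t251_4 _ _ =>
      ![!![0, 1, 0, 0; 0, 0, 0, 0; 0, 0, 0, 0; 0, 0, -1, 0],
        !![0, 0, 0, 1; 0, 0, -1, 0; 0, 0, 0, 0; 0, 0, 0, 0]]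
  | _, .t252_2 _ _ _ =>
      ![!![0, 1, 0, 0; 0, 0, -1, 0; 0, 0, 0, 0; 0, 0, 0, 0],
        !![0, 0, 0, -1; 0, 0, 0, 0; 0, 0, 0, 0; 0, 0, 1, 0]]
  | _, .t331_1 _ =>
      ![!![0, 0, 0, 0; 0, 1, 0, 0; 0, 0, 0, 0; 0, 0, 0, -1],
        !![0, 1, 0, 0; 0, 0, 0, 0; 0, 0, 0, 0; 0, 0, -1, 0],
        !![0, 0, 0, 1; 0, 0, -1, 0; 0, 0, 0, 0; 0, 0, 0, 0]]
  | _, .t332_1 _ =>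
      ![!![0, 0, 0, 0; 0, 0, 0, -1; 0, 0, 0, 0; 0, 1, 0, 0],
        !![0, 1, 0, 0; 0, 0, -1, 0; 0, 0, 0, 0; 0, 0, 0, 0],
        !![0, 0, 0, -1; 0, 0, 0, 0; 0, 0, 0, 0; 0, 0, 1, 0]]

set_option maxHeartbeats 4000000 in
-- Only 𝔪-components enter, so the 𝔥-components of [𝔥, 𝔪] in 1.3¹.1 and 1.4¹.2 are invisible and
-- each family n.mᵏ has a single representation.
theorem PairType.isotropy_eq {n : ℕ} (t : PairType n) :
    ∀ (a : Fin n) (i j : Fin 4),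
      t.bracket (Sum.inl a) (Sum.inr j) (Sum.inr i) = t.isotropy a i j := by
  simp only [PairType.bracket_apply]
  cases t <;> intro a i <;> fin_cases a <;> fin_cases i <;>
    simp [PairType.table, PairType.isotropy, iso111, iso112, iso131, iso141, iso221, iso251,
      iso252, iso331, iso332, Fin.forall_fin_succ]

variable {n : ℕ} {𝔤 : Type*} [LieRing 𝔤] [LieAlgebra ℝ 𝔤] {t : PairType n}
  {B : Module.Basis (PairIdx n) ℝ 𝔤}

theorem IsAdaptedBasis.adMat_isotropy (hB : IsAdaptedBasis t B) (a : Fin n) :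
    adMat B (B (Sum.inl a)) = t.isotropy a := by
  rw [hB.adMat_basis]
  ext i j
  exact t.isotropy_eq a i j

theorem IsAdaptedBasis.commute_isotropy (hB : IsAdaptedBasis t B) {J : Matrix (Fin 4) (Fin 4) ℝ}
    (h : IsInvariantAlmostComplex B J) (a : Fin n) : Commute (t.isotropy a) J :=
  hB.adMat_isotropy a ▸ h.commute a

/-! ### Normal forms of invariant tensors -/

/-- In 2 × 2 blocks, `shift` is the identity in the upper right corner. Invariance kills the upper
left block of `G` and makes the off-diagonal one skew. -/
theorem exists_metric_of_shift {G : Matrix (Fin 4) (Fin 4) ℝ} (hs : G.IsSymm) (hd : G.det ≠ 0)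
    (hi : shift.transpose * G + G * shift = 0) :
    ∃ a b c d : ℝ, a ≠ 0 ∧ G = !![0, 0, 0, a; 0, 0, -a, 0; 0, -a, b, c; a, 0, c, d] := by
  have e : ∀ i j, (shift.transpose * G + G * shift) i j = 0 := fun i j => by rw [hi]; rfl
  simp only [Matrix.add_apply, Matrix.mul_apply, Fin.sum_univ_four, Matrix.transpose_apply] at e
  have h02 := e 0 2
  have h03 := e 0 3
  have h13 := e 1 3
  have h22 := e 2 2
  have h23 := e 2 3
  have h33 := e 3 3
  have s := fun i j => hs.apply i j
  have s01 := s 0 1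
  have s02 := s 0 2
  have s03 := s 0 3
  have s12 := s 1 2
  have s13 := s 1 3
  have s23 := s 2 3
  simp at h02 h03 h13 h22 h23 h33
  have hG : G = !![0, 0, 0, G 0 3; 0, 0, -G 0 3, 0; 0, -G 0 3, G 2 2, G 2 3;
      G 0 3, 0, G 2 3, G 3 3] := by
    ext i j
    fin_cases i <;> fin_cases j <;> simp <;> linarith
  refine ⟨G 0 3, G 2 2, G 2 3, G 3 3, fun h => hd ?_, hG⟩
  rw [hG, h]
  simp [Matrix.det_succ_row_zero, Fin.sum_univ_succ]

/-- Commuting with `shift` gives blocks A, C above 0, A with A² = -1 and AC + CA = 0. The first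
equation makes A traceless with s ≠ 0; then the upper right entry of the second is s · tr C, so C is
traceless too. -/
theorem exists_complex_of_shift {J : Matrix (Fin 4) (Fin 4) ℝ} (hJ : J * J = -1)
    (hc : shift * J = J * shift) :
    ∃ r s t c₁ c₂ c₃ : ℝ, r * r + s * t = -1 ∧
      J = !![r, s, c₁, c₂; t, -r, c₃, -c₁; 0, 0, r, s; 0, 0, t, -r] := by
  have e : ∀ i j, (shift * J) i j = (J * shift) i j := fun i j => by rw [hc]
  have q : ∀ i j, (J * J) i j = (-1 : Matrix (Fin 4) (Fin 4) ℝ) i j := fun i j => by rw [hJ]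
  simp only [Matrix.mul_apply, Fin.sum_univ_four] at e q
  have e00 := e 0 0
  have e01 := e 0 1
  have e02 := e 0 2
  have e03 := e 0 3
  have e10 := e 1 0
  have e11 := e 1 1
  have e12 := e 1 2
  have e13 := e 1 3
  simp at e00 e01 e02 e03 e10 e11 e12 e13
  have q00 := q 0 0
  have q01 := q 0 1
  have q03 := q 0 3
  simp [e00, e01, e03, e10, e11, e13] at q00 q01 q03
  have hs : J 0 1 ≠ 0 := by
    intro h
    rw [h] at q00
    nlinarith [mul_self_nonneg (J 0 0)]
  have h11 : J 1 1 = -J 0 0 := by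
    have : J 0 1 * (J 0 0 + J 1 1) = 0 := by linarith
    linarith [(mul_eq_zero.1 this).resolve_left hs]
  have h13 : J 1 3 = -J 0 2 := by
    rw [h11] at q03
    have : J 0 1 * (J 0 2 + J 1 3) = 0 := by linarith
    linarith [(mul_eq_zero.1 this).resolve_left hs]
  refine ⟨J 0 0, J 0 1, J 1 0, J 0 2, J 0 3, J 1 2, by linarith, ?_⟩
  ext i j
  fin_cases i <;> fin_cases j <;> simp <;> linarith

/-- Image and kernel of `rotation` are orthogonal, and on the image an invariant form is a multiple
of the standard one. -/
theorem exists_metric_of_rotation {G : Matrix (Fin 4) (Fin 4) ℝ} (hs : G.IsSymm)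
    (hd : G.det ≠ 0) (hi : rotation.transpose * G + G * rotation = 0) :
    ∃ a b c d : ℝ, a ≠ 0 ∧ G = !![a, 0, 0, 0; 0, b, 0, c; 0, 0, a, 0; 0, c, 0, d] := by
  have e : ∀ i j, (rotation.transpose * G + G * rotation) i j = 0 := fun i j => by rw [hi]; rfl
  simp only [Matrix.add_apply, Matrix.mul_apply, Fin.sum_univ_four, Matrix.transpose_apply] at e
  have e00 := e 0 0
  have e01 := e 0 1
  have e02 := e 0 2
  have e03 := e 0 3
  have e12 := e 1 2
  have e23 := e 2 3
  have s := fun i j => hs.apply i j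
  have s01 := s 0 1
  have s02 := s 0 2
  have s03 := s 0 3
  have s12 := s 1 2
  have s13 := s 1 3
  have s23 := s 2 3
  simp at e00 e01 e02 e03 e12 e23
  have hG : G = !![G 0 0, 0, 0, 0; 0, G 1 1, 0, G 1 3; 0, 0, G 0 0, 0; 0, G 1 3, 0, G 3 3] := by
    ext i j
    fin_cases i <;> fin_cases j <;> simp <;> linarith
  refine ⟨G 0 0, G 1 1, G 1 3, G 3 3, fun h => hd ?_, hG⟩
  rw [hG, h]
  simp [Matrix.det_succ_row_zero, Fin.sum_univ_succ]

theorem exists_complex_of_rotation {J : Matrix (Fin 4) (Fin 4) ℝ} (hJ : J * J = -1)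
    (hc : rotation * J = J * rotation) :
    ∃ ε r s t : ℝ, ε * ε = 1 ∧ r * r + s * t = -1 ∧
      J = !![0, 0, -ε, 0; 0, r, 0, s; ε, 0, 0, 0; 0, t, 0, -r] := by
  have e : ∀ i j, (rotation * J) i j = (J * rotation) i j := fun i j => by rw [hc]
  have q : ∀ i j, (J * J) i j = (-1 : Matrix (Fin 4) (Fin 4) ℝ) i j := fun i j => by rw [hJ]
  simp only [Matrix.mul_apply, Fin.sum_univ_four] at e q
  have e00 := e 0 0
  have e01 := e 0 1
  have e02 := e 0 2
  have e03 := e 0 3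
  have e10 := e 1 0
  have e12 := e 1 2
  have e20 := e 2 0
  have e21 := e 2 1
  have e22 := e 2 2
  have e23 := e 2 3
  have e30 := e 3 0
  have e32 := e 3 2
  simp at e00 e01 e02 e03 e10 e12 e20 e21 e22 e23 e30 e32
  have h02 : J 0 2 = -J 2 0 := by linarith
  have q00 := q 0 0
  have q02 := q 0 2
  have q11 := q 1 1
  have q13 := q 1 3
  simp [e01, e03, e10.symm, e12, e21, e23, e30.symm, e32, h02] at q00 q02 q11 q13
  -- On span(u₁, u₃), `J` has the form x + y · `rotation`. Its square is -1 only if xy = 0 and x² -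
  -- y² = -1, hence x = 0.
  have h0 : J 0 0 = 0 := by
    by_contra h
    have h1 : J 0 0 * J 2 0 = 0 := by rw [e02] at q02; linarith
    rw [(mul_eq_zero.1 h1).resolve_left h] at q00
    nlinarith [mul_self_nonneg (J 0 0)]
  have hs : J 1 3 ≠ 0 := by
    intro h
    rw [h] at q11
    nlinarith [mul_self_nonneg (J 1 1)]
  have h33 : J 3 3 = -J 1 1 := by
    have : J 1 3 * (J 1 1 + J 3 3) = 0 := by linarith
    linarith [(mul_eq_zero.1 this).resolve_left hs]
  refine ⟨J 2 0, J 1 1, J 1 3, J 3 1, by rw [h0] at q00; linarith, by linarith, ?_⟩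
  ext i j
  fin_cases i <;> fin_cases j <;> simp <;> linarith

end Isotropy

/-! ### Components of the pseudo-Kähler conditions in the basis -/

section Kahler

variable {n : ℕ} {𝔤 : Type*} [LieRing 𝔤] [LieAlgebra ℝ 𝔤] {t : PairType n}
  {B : Module.Basis (PairIdx n) ℝ 𝔤} {G J : Matrix (Fin 4) (Fin 4) ℝ}

theorem IsInvariantAlmostComplex.ne_single (h : IsInvariantAlmostComplex B J)
    {M : Matrix (Fin 4) (Fin 4) ℝ} (hM : Commute M J) (i j : Fin 4) {x : ℝ} (hx : x ≠ 0) :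
    M ≠ Matrix.single i j x := by
  rintro rfl
  exact not_commute_single h.sq i j hx hM

theorem mulVec_single (M : Matrix (Fin 4) (Fin 4) ℝ) (i : Fin 4) :
    M.mulVec (Pi.single i 1) = fun k => M k i := by
  ext k; simp

theorem IsAdaptedBasis.mBracket_single (hB : IsAdaptedBasis t B) (i j : Fin 4) :
    mBracket B (Pi.single i 1) (Pi.single j 1)
      = fun k => t.bracket (Sum.inr i) (Sum.inr j) (Sum.inr k) := by
  rw [mBracket, mVec_single, mVec_single, hB.mPart_lie]

theorem IsAdaptedBasis.mBracket_single_right (hB : IsAdaptedBasis t B) (y : Fin 4 → ℝ)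
    (j k : Fin 4) : mBracket B y (Pi.single j 1) k =
      ∑ i, y i * t.bracket (Sum.inr i) (Sum.inr j) (Sum.inr k) := by
  simp [hB.mBracket_eq, Pi.single_apply]

theorem IsAdaptedBasis.mBracket_single_left (hB : IsAdaptedBasis t B) (z : Fin 4 → ℝ)
    (i k : Fin 4) : mBracket B (Pi.single i 1) z k =
      ∑ j, z j * t.bracket (Sum.inr i) (Sum.inr j) (Sum.inr k) := by
  simp [hB.mBracket_eq, Pi.single_apply]

theorem kahlerForm_single_right (G J : Matrix (Fin 4) (Fin 4) ℝ) (y : Fin 4 → ℝ) (l : Fin 4) :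
    kahlerForm G J y (Pi.single l 1) = ∑ m, y m * ∑ k, J k m * G k l := by
  have : ∀ k, G.mulVec (Pi.single l 1) k = G k l := fun k => by rw [mulVec_single]
  simp only [kahlerForm, form, dotProduct, this]
  simp only [Matrix.mulVec, dotProduct, Finset.sum_mul, Finset.mul_sum]
  rw [Finset.sum_comm]
  exact Finset.sum_congr rfl fun _ _ => Finset.sum_congr rfl fun _ _ => by ring

/-- The components of the exterior derivative of the Kähler form. -/
theorem IsPseudoKahler.closed_apply (hB : IsAdaptedBasis t B) (h : IsPseudoKahler B G J)
    (i j l : Fin 4) :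
    ∑ m, (t.bracket (Sum.inr i) (Sum.inr j) (Sum.inr m) * ∑ k, J k m * G k l)
      + ∑ m, (t.bracket (Sum.inr j) (Sum.inr l) (Sum.inr m) * ∑ k, J k m * G k i)
      + ∑ m, (t.bracket (Sum.inr l) (Sum.inr i) (Sum.inr m) * ∑ k, J k m * G k j) = 0 := by
  have := h.closed (Pi.single i 1) (Pi.single j 1) (Pi.single l 1)
  simpa only [hB.mBracket_single, kahlerForm_single_right] using this

/-- The components of the Nijenhuis tensor. -/
theorem IsPseudoKahler.nijenhuis_apply (hB : IsAdaptedBasis t B) (h : IsPseudoKahler B G J)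
    (i j k : Fin 4) :
    ∑ a, ∑ b, J a i * J b j * t.bracket (Sum.inr a) (Sum.inr b) (Sum.inr k)
      - ∑ m, J k m * ∑ a, J a i * t.bracket (Sum.inr a) (Sum.inr j) (Sum.inr m)
      - ∑ m, J k m * ∑ a, J a j * t.bracket (Sum.inr i) (Sum.inr a) (Sum.inr m)
      - t.bracket (Sum.inr i) (Sum.inr j) (Sum.inr k) = 0 := by
  have := congrFun (h.integrable (Pi.single i 1) (Pi.single j 1)) k
  simpa only [hB.mBracket_single, mulVec_single, Pi.sub_apply, Pi.zero_apply,
    hB.mBracket_eq (fun k => J k i) (fun k => J k j), Matrix.mulVec, dotProduct,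
    hB.mBracket_single_left, hB.mBracket_single_right] using this

theorem IsPseudoKahler.hermitian_apply (h : IsPseudoKahler B G J) (i j : Fin 4) :
    ∑ k, J k i * ∑ m, G k m * J m j = G i j := by
  have := h.hermitian (Pi.single i 1) (Pi.single j 1)
  rw [form_single_left] at this
  simpa [mulVec_single, form, dotProduct, Matrix.mulVec, Pi.single_apply] using this

end Kahler

/-! ### Pairs without invariant almost complex structures -/

section NoComplex

variable {n : ℕ} {𝔤 : Type*} [LieRing 𝔤] [LieAlgebra ℝ 𝔤] {t : PairType n}
  {B : Module.Basis (PairIdx n) ℝ 𝔤} {J : Matrix (Fin 4) (Fin 4) ℝ}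

/-- The eigenvalue 1 of T = `boost` is simple, and T² + T removes the eigenvalues 0 and -1, leaving
twice a matrix unit. -/
theorem IsAdaptedBasis.isotropy_ne_boost (hB : IsAdaptedBasis t B)
    (hJ : IsInvariantAlmostComplex B J) (a : Fin n) : t.isotropy a ≠ boost := by
  intro h
  have hc := hB.commute_isotropy hJ a
  refine hJ.ne_single ((hc.mul_left hc).add_left hc) 0 0 two_ne_zero ?_
  rw [h]
  ext i j
  fin_cases i <;> fin_cases j <;> norm_num [Matrix.mul_apply, Fin.sum_univ_four, Matrix.single]

theorem IsAdaptedBasis.isotropy_ne_diagonal (hB : IsAdaptedBasis t B)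
    (hJ : IsInvariantAlmostComplex B J) (a : Fin n) :
    t.isotropy a ≠ !![0, 0, 0, 0; 0, 1, 0, 0; 0, 0, 0, 0; 0, 0, 0, -1] := by
  intro h
  have hc := hB.commute_isotropy hJ a
  refine hJ.ne_single ((hc.mul_left hc).add_left hc) 1 1 two_ne_zero ?_
  rw [h]
  ext i j
  fin_cases i <;> fin_cases j <;> norm_num [Matrix.mul_apply, Fin.sum_univ_four, Matrix.single]

theorem IsAdaptedBasis.isotropy_mul_ne (hB : IsAdaptedBasis t B)
    (hJ : IsInvariantAlmostComplex B J) (a b : Fin n) {x : ℝ} (hx : x ≠ 0) :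
    t.isotropy a * t.isotropy b ≠ Matrix.single 0 2 x :=
  hJ.ne_single ((hB.commute_isotropy hJ a).mul_left (hB.commute_isotropy hJ b)) 0 2 hx

end NoComplex

/-! ### Pairs of type `1.3¹` -/

section Shift

/-- The invariant metrics of the pairs of type `1.3¹`. -/
abbrev shiftMetric (a b c d : ℝ) : Matrix (Fin 4) (Fin 4) ℝ :=
  !![0, 0, 0, a; 0, 0, -a, 0; 0, -a, b, c; a, 0, c, d]

/-- The invariant almost complex structures of the pairs of type `1.3¹`. -/
abbrev shiftComplex (r s t c₁ c₂ c₃ : ℝ) : Matrix (Fin 4) (Fin 4) ℝ :=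
  !![r, s, c₁, c₂; t, -r, c₃, -c₁; 0, 0, r, s; 0, 0, t, -r]

variable {𝔤 : Type*} [LieRing 𝔤] [LieAlgebra ℝ 𝔤] {B : Module.Basis (PairIdx 1) ℝ 𝔤}
  {a b c d r s t c₁ c₂ c₃ : ℝ}

theorem ne_zero_of_mul_self_add {r s t : ℝ} (hr : r * r + s * t = -1) : s ≠ 0 ∧ t ≠ 0 := by
  constructor <;> rintro rfl <;> nlinarith [mul_self_nonneg r]

/-- Closedness gives r = 0 and ps = 0, so p = 0. The Nijenhuis component is then st = -1, not zero.
-/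
theorem not_isPseudoKahler_t131_2 {p : ℝ} (hB : IsAdaptedBasis (.t131_2 p) B)
    (ha : a ≠ 0) (hr : r * r + s * t = -1) :
    ¬ IsPseudoKahler B (shiftMetric a b c d) (shiftComplex r s t c₁ c₂ c₃) := by
  intro h
  obtain ⟨hs, ht⟩ := ne_zero_of_mul_self_add hr
  have k1 := h.closed_apply hB 0 2 3
  have k2 := h.closed_apply hB 1 2 3
  have k3 := h.nijenhuis_apply hB 3 0 0
  simp [PairType.bracket_apply, PairType.table, iso131, Fin.sum_univ_four, -mul_eq_zero] at k1 k2 k3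
  grind

theorem not_isPseudoKahler_t131_3 (hB : IsAdaptedBasis .t131_3 B) :
    ¬ IsPseudoKahler B (shiftMetric a b c d) (shiftComplex r s t c₁ c₂ c₃) := by
  intro h
  -- This component is r² + 1, so no complex structure of this shape is integrable, whatever the
  -- metric.
  have k1 := h.nijenhuis_apply hB 2 0 0
  simp [PairType.bracket_apply, PairType.table, iso131, Fin.sum_univ_four, -mul_eq_zero] at k1
  nlinarith [mul_self_nonneg r]

theorem not_isPseudoKahler_t131_6 (hB : IsAdaptedBasis .t131_6 B)
    (ha : a ≠ 0) (hr : r * r + s * t = -1) :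
    ¬ IsPseudoKahler B (shiftMetric a b c d) (shiftComplex r s t c₁ c₂ c₃) := by
  intro h
  have ht := (ne_zero_of_mul_self_add hr).2
  have k1 := h.closed_apply hB 0 2 3
  simp [PairType.bracket_apply, PairType.table, iso131, Fin.sum_univ_four, -mul_eq_zero] at k1
  obtain rfl : s = t := mul_right_cancel₀ ha (by linarith)
  nlinarith [mul_self_nonneg r, mul_self_nonneg s]

/-- Closedness amounts to r = t and s = pt. The Nijenhuis component then reduces to p/(1 + p), so p
= 0 and s = 0, which is excluded. -/
theorem not_isPseudoKahler_t131_7 {p : ℝ} (hp : p ≠ -1) (hB : IsAdaptedBasis (.t131_7 p) B)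
    (ha : a ≠ 0) (hr : r * r + s * t = -1) :
    ¬ IsPseudoKahler B (shiftMetric a b c d) (shiftComplex r s t c₁ c₂ c₃) := by
  intro h
  obtain ⟨hs, ht⟩ := ne_zero_of_mul_self_add hr
  have k1 := h.closed_apply hB 0 2 3
  have k2 := h.closed_apply hB 1 2 3
  have k3 := h.nijenhuis_apply hB 2 0 0
  simp [PairType.bracket_apply, PairType.table, iso131, Fin.sum_univ_four, -mul_eq_zero] at k1 k2 k3
  grind

/-- Here, and for the items 9, 11, 13, 19, 20 and 22, the component dΩ(u₁, u₃, u₄) is a non-zero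
multiple of Ω(u₃, u₁) = ta. -/
theorem not_isPseudoKahler_t131_8 (hB : IsAdaptedBasis .t131_8 B)
    (ha : a ≠ 0) (hr : r * r + s * t = -1) :
    ¬ IsPseudoKahler B (shiftMetric a b c d) (shiftComplex r s t c₁ c₂ c₃) := by
  intro h
  have ht := (ne_zero_of_mul_self_add hr).2
  have k1 := h.closed_apply hB 0 2 3
  simp [PairType.bracket_apply, PairType.table, iso131, Fin.sum_univ_four, -mul_eq_zero] at k1
  grind

theorem not_isPseudoKahler_t131_9 {p : ℝ} (hp : p ≠ 0) (hB : IsAdaptedBasis (.t131_9 p) B)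
    (ha : a ≠ 0) (hr : r * r + s * t = -1) :
    ¬ IsPseudoKahler B (shiftMetric a b c d) (shiftComplex r s t c₁ c₂ c₃) := by
  intro h
  have ht := (ne_zero_of_mul_self_add hr).2
  have k1 := h.closed_apply hB 0 2 3
  simp [PairType.bracket_apply, PairType.table, iso131, Fin.sum_univ_four, -mul_eq_zero] at k1
  grind

theorem not_isPseudoKahler_t131_11 (hB : IsAdaptedBasis .t131_11 B)
    (ha : a ≠ 0) (hr : r * r + s * t = -1) :
    ¬ IsPseudoKahler B (shiftMetric a b c d) (shiftComplex r s t c₁ c₂ c₃) := by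
  intro h
  have ht := (ne_zero_of_mul_self_add hr).2
  have k1 := h.closed_apply hB 0 2 3
  simp [PairType.bracket_apply, PairType.table, iso131, Fin.sum_univ_four, -mul_eq_zero] at k1
  grind

theorem not_isPseudoKahler_t131_13 {p : ℝ} (hB : IsAdaptedBasis (.t131_13 p) B)
    (ha : a ≠ 0) (hr : r * r + s * t = -1) :
    ¬ IsPseudoKahler B (shiftMetric a b c d) (shiftComplex r s t c₁ c₂ c₃) := by
  intro h
  have ht := (ne_zero_of_mul_self_add hr).2
  have k1 := h.closed_apply hB 0 2 3
  simp [PairType.bracket_apply, PairType.table, iso131, Fin.sum_univ_four, -mul_eq_zero] at k1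
  grind

/-- Closedness leaves p = -1, where the Nijenhuis component (1 - p)t² is not zero. -/
theorem not_isPseudoKahler_t131_14 {p : ℝ} (hB : IsAdaptedBasis (.t131_14 p) B)
    (ha : a ≠ 0) (hr : r * r + s * t = -1) :
    ¬ IsPseudoKahler B (shiftMetric a b c d) (shiftComplex r s t c₁ c₂ c₃) := by
  intro h
  obtain ⟨hs, ht⟩ := ne_zero_of_mul_self_add hr
  have k1 := h.closed_apply hB 0 2 3
  have k2 := h.nijenhuis_apply hB 2 0 1
  simp [PairType.bracket_apply, PairType.table, iso131, Fin.sum_univ_four, -mul_eq_zero] at k1 k2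
  grind

theorem not_isPseudoKahler_t131_19 (hB : IsAdaptedBasis .t131_19 B)
    (ha : a ≠ 0) (hr : r * r + s * t = -1) :
    ¬ IsPseudoKahler B (shiftMetric a b c d) (shiftComplex r s t c₁ c₂ c₃) := by
  intro h
  have ht := (ne_zero_of_mul_self_add hr).2
  have k1 := h.closed_apply hB 0 2 3
  simp [PairType.bracket_apply, PairType.table, iso131, Fin.sum_univ_four, -mul_eq_zero] at k1
  grind

theorem not_isPseudoKahler_t131_20 (hB : IsAdaptedBasis .t131_20 B)
    (ha : a ≠ 0) (hr : r * r + s * t = -1) :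
    ¬ IsPseudoKahler B (shiftMetric a b c d) (shiftComplex r s t c₁ c₂ c₃) := by
  intro h
  have ht := (ne_zero_of_mul_self_add hr).2
  have k1 := h.closed_apply hB 0 2 3
  simp [PairType.bracket_apply, PairType.table, iso131, Fin.sum_univ_four, -mul_eq_zero] at k1
  grind

/-- Closedness leaves p = 2, where the Nijenhuis component is t². -/
theorem not_isPseudoKahler_t131_21 {p : ℝ} (hB : IsAdaptedBasis (.t131_21 p) B)
    (ha : a ≠ 0) (hr : r * r + s * t = -1) :
    ¬ IsPseudoKahler B (shiftMetric a b c d) (shiftComplex r s t c₁ c₂ c₃) := by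
  intro h
  obtain ⟨hs, ht⟩ := ne_zero_of_mul_self_add hr
  have k1 := h.closed_apply hB 0 2 3
  have k2 := h.nijenhuis_apply hB 2 0 0
  simp [PairType.bracket_apply, PairType.table, iso131, Fin.sum_univ_four, -mul_eq_zero] at k1 k2
  grind

theorem not_isPseudoKahler_t131_22 (hB : IsAdaptedBasis .t131_22 B)
    (ha : a ≠ 0) (hr : r * r + s * t = -1) :
    ¬ IsPseudoKahler B (shiftMetric a b c d) (shiftComplex r s t c₁ c₂ c₃) := by
  intro h
  have ht := (ne_zero_of_mul_self_add hr).2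
  have k1 := h.closed_apply hB 0 2 3
  simp [PairType.bracket_apply, PairType.table, iso131, Fin.sum_univ_four, -mul_eq_zero] at k1
  grind

theorem not_isPseudoKahler_t131_28 (hB : IsAdaptedBasis .t131_28 B)
    (ha : a ≠ 0) (hr : r * r + s * t = -1) :
    ¬ IsPseudoKahler B (shiftMetric a b c d) (shiftComplex r s t c₁ c₂ c₃) := by
  intro h
  obtain ⟨hs, ht⟩ := ne_zero_of_mul_self_add hr
  have k1 := h.closed_apply hB 1 2 3
  simp [PairType.bracket_apply, PairType.table, iso131, Fin.sum_univ_four, -mul_eq_zero] at k1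
  grind

end Shift

/-! ### The pairs 1.3¹.1, 1.3¹.5 and 1.3¹.12: pseudo-Kähler metrics are Ricci-flat -/

section ShiftEinstein

variable {𝔤 : Type*} [LieRing 𝔤] [LieAlgebra ℝ 𝔤] {B : Module.Basis (PairIdx 1) ℝ 𝔤}
  {a b c d r s t c₁ c₂ c₃ : ℝ}

theorem det_shiftMetric_ne_zero (ha : a ≠ 0) (b c d : ℝ) : (shiftMetric a b c d).det ≠ 0 := by
  have : (shiftMetric a b c d).det = a ^ 4 := by
    simp [Matrix.det_succ_row_zero, Fin.sum_univ_succ, Fin.succAbove]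
    ring
  rw [this]
  positivity

/-- A Hermitian form of the complex structure `!![r, s; t, -r]` on the plane is determined by its
fundamental form. -/
theorem hermitian_plane (hr : r * r + s * t = -1)
    (h11 : r * (b * r + c * t) + t * (c * r + d * t) = b)
    (h12 : r * (b * s - c * r) + t * (c * s - d * r) = c)
    (h22 : s * (b * s - c * r) - r * (c * s - d * r) = d) :
    b = (r * c + t * d) * t ∧ c = -((r * c + t * d) * r) ∧ d = -((r * c + t * d) * s) := by
  -- For A = !![r, s; t, -r] and g the form, AᵗgA = g and A² = -1 mean that gA is skew; `e1`, `e2`,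
  -- `e3` say so entrywise. The conclusion is g = -(gA)A.
  have e1 : r * b + t * c = 0 := by
    linear_combination (-1 / 2) * r * h11 - (1 / 2) * t * h12 + (1 / 2) * (r * b + t * c) * hr
  have e2 : s * c - r * d = 0 := by
    linear_combination (-1 / 2) * s * h12 + (1 / 2) * r * h22 + (1 / 2) * (s * c - r * d) * hr
  have e3 : s * b + t * d = 0 := by
    linear_combination -s * h11 + r * h12 + (r * c + t * d) * hr
  refine ⟨?_, ?_, ?_⟩
  · linear_combination b * hr - r * e1 - t * e3
  · linear_combination c * hr - t * e2
  · linear_combination d * hr + r * e2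

set_option maxHeartbeats 1000000 in
theorem ricci_t131_1 (hB : IsAdaptedBasis (.t131_1) B) (ha : a ≠ 0) :
    ricci B (shiftMetric a b 0 0) = 0 := by
  have hd := det_shiftMetric_ne_zero ha b 0 0
  have h0 := hB.leviCivita_inl hd 0
    shift (by
      intro k j
      fin_cases k <;> fin_cases j <;>
        simp [PairType.bracket_apply, PairType.table, iso131, Fin.sum_univ_four] <;> ring)
  have h1 := hB.leviCivita_inr hd 0
    !![-1 / 2, 0, 0, 0; 0, -1 / 2, b / (2 * a), 0; 0, 0, 1 / 2, 0; 0, 0, 0, 1 / 2] (by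
      intro k j
      fin_cases k <;> fin_cases j <;>
        simp [PairType.bracket_apply, PairType.table, iso131, Fin.sum_univ_four] <;>
        field_simp <;> ring)
  have h2 := hB.leviCivita_inr hd 1
    0 (by
      intro k j
      fin_cases k <;> fin_cases j <;>
        simp [PairType.bracket_apply, PairType.table, iso131, Fin.sum_univ_four] <;> ring)
  have h3 := hB.leviCivita_inr hd 2
    !![0, 0, 0, 0; b / (2 * a), 0, 0, 0; -1 / 2, 0, 0, 0; 0, -1 / 2, b / a, 0] (by
      intro k j
      fin_cases k <;> fin_cases j <;>
        simp [PairType.bracket_apply, PairType.table, iso131, Fin.sum_univ_four] <;>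
        field_simp <;> ring)
  have h4 := hB.leviCivita_inr hd 3
    0 (by
      intro k j
      fin_cases k <;> fin_cases j <;>
        simp [PairType.bracket_apply, PairType.table, iso131, Fin.sum_univ_four])
  ext i j
  rw [hB.ricci_apply]
  simp only [Fintype.sum_sum_type, Fin.sum_univ_four, Finset.univ_unique, Finset.sum_singleton,
    Fin.default_eq_zero, h0, h1, h2, h3, h4, PairType.bracket_apply]
  fin_cases i <;> fin_cases j <;>
    simp [h1, h2, h3, h4, PairType.table, iso131] <;> ring

set_option maxHeartbeats 1000000 in
-- These are the only parameters that survive the closedness and Nijenhuis equations; no condition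
-- on the metric is needed.
theorem ricci_t131_5 (hB : IsAdaptedBasis (.t131_5 0 2) B) (ha : a ≠ 0) :
    ricci B (shiftMetric a b c d) = 0 := by
  have hd := det_shiftMetric_ne_zero ha b c d
  have h0 := hB.leviCivita_inl hd 0
    shift (by
      intro k j
      fin_cases k <;> fin_cases j <;>
        simp [PairType.bracket_apply, PairType.table, iso131, Fin.sum_univ_four] <;> ring)
  have h1 := hB.leviCivita_inr hd 0
    0 (by
      intro k j
      fin_cases k <;> fin_cases j <;>
        simp [PairType.bracket_apply, PairType.table, iso131, Fin.sum_univ_four])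
  have h2 := hB.leviCivita_inr hd 1
    !![0, 0, 2, 0; 0, 0, 0, 2; 0, 0, 0, 0; 0, 0, 0, 0] (by
      intro k j
      fin_cases k <;> fin_cases j <;>
        simp [PairType.bracket_apply, PairType.table, iso131, Fin.sum_univ_four] <;> ring)
  have h3 := hB.leviCivita_inr hd 2
    !![0, 1, d / a, -c / a; -1, 0, -c / a, b / a; 0, 0, 0, 1; 0, 0, -1, 0] (by
      intro k j
      fin_cases k <;> fin_cases j <;>
        simp [PairType.bracket_apply, PairType.table, iso131, Fin.sum_univ_four] <;>
        field_simp <;> ring)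
  have h4 := hB.leviCivita_inr hd 3
    !![-1, 0, -c / a, -d / a; 0, -1, b / a, c / a; 0, 0, 1, 0; 0, 0, 0, 1] (by
      intro k j
      fin_cases k <;> fin_cases j <;>
        simp [PairType.bracket_apply, PairType.table, iso131, Fin.sum_univ_four] <;>
        field_simp <;> ring)
  ext i j
  rw [hB.ricci_apply]
  simp only [Fintype.sum_sum_type, Fin.sum_univ_four, Finset.univ_unique, Finset.sum_singleton,
    Fin.default_eq_zero, h0, h1, h2, h3, h4, PairType.bracket_apply]
  fin_cases i <;> fin_cases j <;>
    simp [h1, h2, h3, h4, PairType.table, iso131] <;> ring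

set_option maxHeartbeats 1000000 in
theorem ricci_t131_12 (hB : IsAdaptedBasis (.t131_12 1 2) B) (ha : a ≠ 0) :
    ricci B (shiftMetric a b c d) = 0 := by
  have hd := det_shiftMetric_ne_zero ha b c d
  have h0 := hB.leviCivita_inl hd 0
    shift (by
      intro k j
      fin_cases k <;> fin_cases j <;>
        simp [PairType.bracket_apply, PairType.table, iso131, Fin.sum_univ_four] <;> ring)
  have h1 := hB.leviCivita_inr hd 0
    0 (by
      intro k j
      fin_cases k <;> fin_cases j <;>
        simp [PairType.bracket_apply, PairType.table, iso131, Fin.sum_univ_four])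
  have h2 := hB.leviCivita_inr hd 1
    !![0, 0, 2, 0; 0, 0, 0, 2; 0, 0, 0, 0; 0, 0, 0, 0] (by
      intro k j
      fin_cases k <;> fin_cases j <;>
        simp [PairType.bracket_apply, PairType.table, iso131, Fin.sum_univ_four] <;> ring)
  have h3 := hB.leviCivita_inr hd 2
    !![0, 0, b / a, 0; 0, 0, 0, b / a; 0, 0, 0, 0; 0, 0, 0, 0] (by
      intro k j
      fin_cases k <;> fin_cases j <;>
        simp [PairType.bracket_apply, PairType.table, iso131, Fin.sum_univ_four] <;>
        field_simp <;> ring)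
  have h4 := hB.leviCivita_inr hd 3
    !![-1, 0, 0, -d / a; 0, -1, b / a, 2 * c / a; 0, 0, 1, 0; 0, 0, 0, 1] (by
      intro k j
      fin_cases k <;> fin_cases j <;>
        simp [PairType.bracket_apply, PairType.table, iso131, Fin.sum_univ_four] <;>
        field_simp <;> ring)
  ext i j
  rw [hB.ricci_apply]
  simp only [Fintype.sum_sum_type, Fin.sum_univ_four, Finset.univ_unique, Finset.sum_singleton,
    Fin.default_eq_zero, h0, h1, h2, h3, h4, PairType.bracket_apply]
  fin_cases i <;> fin_cases j <;>
    simp [h1, h2, h3, h4, PairType.table, iso131] <;> ring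

theorem ricci_eq_zero_of_isPseudoKahler_t131_1 (hB : IsAdaptedBasis .t131_1 B) (ha : a ≠ 0)
    (hr : r * r + s * t = -1)
    (h : IsPseudoKahler B (shiftMetric a b c d) (shiftComplex r s t c₁ c₂ c₃)) :
    ricci B (shiftMetric a b c d) = 0 := by
  obtain ⟨hs, ht⟩ := ne_zero_of_mul_self_add hr
  have k0 := h.closed_apply hB 0 2 3
  have k1 := h.nijenhuis_apply hB 2 1 0
  have k2 := h.nijenhuis_apply hB 2 1 1
  have k3 := h.nijenhuis_apply hB 3 1 0
  have k4 := h.hermitian_apply 2 2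
  have k5 := h.hermitian_apply 2 3
  have k6 := h.hermitian_apply 3 3
  simp [PairType.bracket_apply, PairType.table, iso131, Fin.sum_univ_four, -mul_eq_zero]
    at k0 k1 k2 k3 k4 k5 k6
  clear h
  have z1 : c₁ = 0 := by grind
  have z2 : c₂ = 0 := by grind
  have z3 : c₃ = 0 := by grind
  subst z1 z2 z3
  obtain ⟨e1, e2, e3⟩ := hermitian_plane (b := b) (c := c) (d := d) hr (by linarith)
    (by linarith) (by linarith)
  -- Ω is skew on span(u₃, u₄), so the closedness equation `k0` becomes a multiple of Ω(u₃, u₄) = rc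
  -- + td.
  have e0 : r * c + t * d = 0 := by
    have : s * b - r * c = -(r * c + t * d) := by
      linear_combination s * e1 - r * e2 + (r * c + t * d) * hr
    linarith
  obtain rfl : c = 0 := by rw [e2, e0]; ring
  obtain rfl : d = 0 := by rw [e3, e0]; ring
  exact ricci_t131_1 hB ha

theorem ricci_eq_zero_of_isPseudoKahler_t131_5 {p q : ℝ} (hq : q ≠ 1)
    (hB : IsAdaptedBasis (.t131_5 p q) B) (ha : a ≠ 0) (hr : r * r + s * t = -1)
    (h : IsPseudoKahler B (shiftMetric a b c d) (shiftComplex r s t c₁ c₂ c₃)) :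
    ricci B (shiftMetric a b c d) = 0 := by
  obtain ⟨hs, ht⟩ := ne_zero_of_mul_self_add hr
  have k0 := h.closed_apply hB 0 2 3
  have k1 := h.closed_apply hB 1 2 3
  have k2 := h.nijenhuis_apply hB 3 1 0
  have k3 := h.nijenhuis_apply hB 2 1 0
  simp [PairType.bracket_apply, PairType.table, iso131, Fin.sum_univ_four, -mul_eq_zero]
    at k0 k1 k2 k3
  clear h
  obtain rfl : p = 0 := by grind
  obtain rfl : q = 2 := by grind
  exact ricci_t131_5 hB ha

theorem ricci_eq_zero_of_isPseudoKahler_t131_12 {p q : ℝ} (hB : IsAdaptedBasis (.t131_12 p q) B)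
    (ha : a ≠ 0) (hr : r * r + s * t = -1)
    (h : IsPseudoKahler B (shiftMetric a b c d) (shiftComplex r s t c₁ c₂ c₃)) :
    ricci B (shiftMetric a b c d) = 0 := by
  have ht := (ne_zero_of_mul_self_add hr).2
  have k0 := h.closed_apply hB 0 2 3
  have k1 := h.nijenhuis_apply hB 2 0 1
  simp [PairType.bracket_apply, PairType.table, iso131, Fin.sum_univ_four, -mul_eq_zero] at k0 k1
  clear h
  -- dΩ(u₁, u₃, u₄) is a multiple of (2 - q)ta; for q = 2 the Nijenhuis component is (1 - p)t².
  obtain rfl : q = 2 := by grind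
  obtain rfl : p = 1 := by grind
  exact ricci_t131_12 hB ha

end ShiftEinstein

/-! ### Pairs of type `1.1²` -/

section Rotation

/-- The invariant metrics of the pairs of type `1.1²`. -/
abbrev rotationMetric (a b c d : ℝ) : Matrix (Fin 4) (Fin 4) ℝ :=
  !![a, 0, 0, 0; 0, b, 0, c; 0, 0, a, 0; 0, c, 0, d]

/-- The invariant almost complex structures of the pairs of type `1.1²`. -/
abbrev rotationComplex (ε r s t : ℝ) : Matrix (Fin 4) (Fin 4) ℝ :=
  !![0, 0, -ε, 0; 0, r, 0, s; ε, 0, 0, 0; 0, t, 0, -r]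

variable {𝔤 : Type*} [LieRing 𝔤] [LieAlgebra ℝ 𝔤] {B : Module.Basis (PairIdx 1) ℝ 𝔤}
  {a b c d ε r s t lam : ℝ} {X : Fin 4 → ℝ}

theorem det_rotationMetric (a b c d : ℝ) :
    (rotationMetric a b c d).det = a ^ 2 * (b * d - c ^ 2) := by
  simp [Matrix.det_succ_row_zero, Fin.sum_univ_succ, Fin.succAbove]
  ring

theorem isEinstein_of_adMat_eq_zero {n : ℕ} {B : Module.Basis (PairIdx n) ℝ 𝔤}
    {G : Matrix (Fin 4) (Fin 4) ℝ} (h : IsRicciSoliton B G X lam) (hX : adMat B (mVec B X) = 0) :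
    IsEinstein B G :=
  ⟨lam, by simpa [IsRicciSoliton, lieDerivMetric, hX] using h⟩

theorem hermitian_of_rotation (hr : r * r + s * t = -1)
    (h : IsPseudoKahler B (rotationMetric a b c d) (rotationComplex ε r s t)) :
    b = (r * c + t * d) * t ∧ c = -((r * c + t * d) * r) ∧ d = -((r * c + t * d) * s) := by
  have k1 := h.hermitian_apply 1 1
  have k2 := h.hermitian_apply 1 3
  have k3 := h.hermitian_apply 3 3
  simp [Fin.sum_univ_four] at k1 k2 k3
  exact hermitian_plane hr (by linarith) (by linarith) (by linarith)

/-- The component of dΩ is ±2εa, because ad u₄ scales the plane span(u₁, u₃) modulo 𝔥. -/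
theorem not_isPseudoKahler_t112_2 {p : ℝ} (hB : IsAdaptedBasis (.t112_2 p) B) (ha : a ≠ 0)
    (hε : ε * ε = 1) :
    ¬ IsPseudoKahler B (rotationMetric a b c d) (rotationComplex ε r s t) := by
  intro h
  have k := h.closed_apply hB 0 2 3
  simp [PairType.bracket_apply, PairType.table, iso112, Fin.sum_univ_four, -mul_eq_zero] at k
  clear h
  have : ε ≠ 0 := by rintro rfl; simp at hε
  exact mul_ne_zero this ha (by linarith)

set_option maxHeartbeats 1000000 in
theorem ricci_t112_1 (hB : IsAdaptedBasis .t112_1 B) (ha : a ≠ 0) (hb : b ≠ 0)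
    (hd : b * d - c ^ 2 = 4 * a ^ 2) :
    ricci B (rotationMetric a b c d) = (-3 * b / (2 * a ^ 2)) • rotationMetric a b c d := by
  -- Eliminating d leaves only a and b as denominators in the connection matrices.
  obtain rfl : d = (4 * a ^ 2 + c ^ 2) / b := by
    field_simp
    linarith
  have hd : (rotationMetric a b c ((4 * a ^ 2 + c ^ 2) / b)).det ≠ 0 := by
    rw [det_rotationMetric, hd]
    positivity
  have h0 := hB.leviCivita_inl hd 0
    rotation (by
      intro k j
      fin_cases k <;> fin_cases j <;>
        simp [PairType.bracket_apply, PairType.table, iso112, Fin.sum_univ_four] <;> ring)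
  have h1 := hB.leviCivita_inr hd 0
    !![0, 0, 0, 1; c / (4 * a), 0, -1 / 2, 0; 0, b / (2 * a), 0, c / (2 * a);
      -b / (4 * a), 0, 0, 0] (by
      intro k j
      fin_cases k <;> fin_cases j <;>
        simp [PairType.bracket_apply, PairType.table, iso112, Fin.sum_univ_four] <;>
        field_simp <;> ring)
  have h2 := hB.leviCivita_inr hd 1
    !![0, 0, -b / (2 * a), 0; 0, b * c / (2 * a ^ 2), 0, c ^ 2 / (2 * a ^ 2) + 2;
      b / (2 * a), 0, 0, 0;
      0, -b ^ 2 / (2 * a ^ 2), 0, -b * c / (2 * a ^ 2)] (by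
      intro k j
      fin_cases k <;> fin_cases j <;>
        simp [PairType.bracket_apply, PairType.table, iso112, Fin.sum_univ_four] <;>
        field_simp <;> ring)
  have h3 := hB.leviCivita_inr hd 2
    !![0, -b / (2 * a), 0, -c / (2 * a); 1 / 2, 0, c / (4 * a), 0;
      0, 0, 0, 1; 0, 0, -b / (4 * a), 0] (by
      intro k j
      fin_cases k <;> fin_cases j <;>
        simp [PairType.bracket_apply, PairType.table, iso112, Fin.sum_univ_four] <;>
        field_simp <;> ring)
  have h4 := hB.leviCivita_inr hd 3
    !![0, 0, -c / (2 * a), 0; 0, c ^ 2 / (2 * a ^ 2), 0, c ^ 3 / (2 * a ^ 2 * b) + 2 * c / b;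
      c / (2 * a), 0, 0, 0;
      0, -b * c / (2 * a ^ 2), 0, -c ^ 2 / (2 * a ^ 2)] (by
      intro k j
      fin_cases k <;> fin_cases j <;>
        simp [PairType.bracket_apply, PairType.table, iso112, Fin.sum_univ_four] <;>
        field_simp <;> ring)
  ext i j
  rw [hB.ricci_apply]
  simp only [Fintype.sum_sum_type, Fin.sum_univ_four, Finset.univ_unique, Finset.sum_singleton,
    Fin.default_eq_zero, h0, h1, h2, h3, h4, PairType.bracket_apply]
  fin_cases i <;> fin_cases j <;>
    simp [h1, h2, h3, h4, PairType.table, iso112] <;> field_simp <;> ring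

/-- Closedness reads rc + td = -2εa, and the form on span(u₂, u₄) has determinant (rc + td)² = 4a²:
exactly the condition for the Einstein metric of `ricci_t112_1`. -/
theorem isEinstein_of_isPseudoKahler_t112_1 (hB : IsAdaptedBasis .t112_1 B) (ha : a ≠ 0)
    (hε : ε * ε = 1) (hr : r * r + s * t = -1)
    (h : IsPseudoKahler B (rotationMetric a b c d) (rotationComplex ε r s t)) :
    IsEinstein B (rotationMetric a b c d) := by
  have ht := (ne_zero_of_mul_self_add hr).2
  obtain ⟨e1, e2, e3⟩ := hermitian_of_rotation hr h
  have k := h.closed_apply hB 0 2 3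
  simp [PairType.bracket_apply, PairType.table, iso112, Fin.sum_univ_four, -mul_eq_zero] at k
  clear h
  have e0 : r * c + t * d = -2 * (ε * a) := by linarith
  have hε0 : ε ≠ 0 := by rintro rfl; simp at hε
  rw [e0] at e1 e2 e3
  refine ⟨_, ricci_t112_1 hB ha ?_ ?_⟩
  · rw [e1]
    exact mul_ne_zero (mul_ne_zero (by norm_num) (mul_ne_zero hε0 ha)) ht
  · rw [e1, e2, e3]
    linear_combination -4 * ε ^ 2 * a ^ 2 * hr + 4 * a ^ 2 * hε

set_option maxHeartbeats 1000000 in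
-- Λ(u₁) = Λ(u₃) = 0, and on span(u₂, u₄) the Ricci tensor is that of a surface of curvature -b/D.
theorem ricci_t112_67 {t : PairType 1} (ht : t = .t112_6 ∨ t = .t112_7) (hB : IsAdaptedBasis t B)
    (ha : a ≠ 0) (hb : b ≠ 0) {D : ℝ} (hD : D ≠ 0) (hd : b * d - c ^ 2 = D) :
    ricci B (rotationMetric a b c d) 1 1 = -b / D * b ∧
      ricci B (rotationMetric a b c d) 1 3 = -b / D * c ∧
      ricci B (rotationMetric a b c d) 3 3 = -b / D * d := by
  obtain rfl : d = (D + c ^ 2) / b := by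
    field_simp
    linarith
  have hd : (rotationMetric a b c ((D + c ^ 2) / b)).det ≠ 0 := by
    rw [det_rotationMetric, hd]
    positivity
  have h0 := hB.leviCivita_inl hd 0
    rotation (by
      intro k j
      rcases ht with rfl | rfl <;> fin_cases k <;> fin_cases j <;>
        simp [PairType.bracket_apply, PairType.table, iso112, Fin.sum_univ_four] <;> ring)
  have h1 := hB.leviCivita_inr hd 0
    0 (by
      intro k j
      rcases ht with rfl | rfl <;> fin_cases k <;> fin_cases j <;>
        simp [PairType.bracket_apply, PairType.table, iso112, Fin.sum_univ_four])
  have h2 := hB.leviCivita_inr hd 1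
    !![0, 0, 0, 0; 0, b * c / D, 0, c ^ 2 / D + 1; 0, 0, 0, 0; 0, -b ^ 2 / D, 0, -b * c / D] (by
      intro k j
      rcases ht with rfl | rfl <;> fin_cases k <;> fin_cases j <;>
        simp [PairType.bracket_apply, PairType.table, iso112, Fin.sum_univ_four] <;>
        field_simp <;> ring)
  have h3 := hB.leviCivita_inr hd 2
    0 (by
      intro k j
      rcases ht with rfl | rfl <;> fin_cases k <;> fin_cases j <;>
        simp [PairType.bracket_apply, PairType.table, iso112, Fin.sum_univ_four])
  have h4 := hB.leviCivita_inr hd 3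
    !![0, 0, 0, 0; 0, c ^ 2 / D, 0, c ^ 3 / (D * b) + c / b;
      0, 0, 0, 0; 0, -b * c / D, 0, -c ^ 2 / D] (by
      intro k j
      rcases ht with rfl | rfl <;> fin_cases k <;> fin_cases j <;>
        simp [PairType.bracket_apply, PairType.table, iso112, Fin.sum_univ_four] <;>
        field_simp <;> ring)
  simp only [hB.ricci_apply, Fintype.sum_sum_type, Fin.sum_univ_four, Finset.univ_unique,
    Finset.sum_singleton, Fin.default_eq_zero, h0, h1, h2, h3, h4, PairType.bracket_apply]
  rcases ht with rfl | rfl <;> refine ⟨?_, ?_, ?_⟩ <;>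
    simp [PairType.table, iso112] <;> field_simp <;> ring

theorem adMat_mVec_t112_67 {t : PairType 1} (ht : t = .t112_6 ∨ t = .t112_7)
    (hB : IsAdaptedBasis t B) (X : Fin 4 → ℝ) :
    adMat B (mVec B X) = !![0, 0, 0, 0; 0, -X 3, 0, X 1; 0, 0, 0, 0; 0, 0, 0, 0] := by
  ext i j
  rw [adMat_mVec, hB.mBracket_single_right]
  rcases ht with rfl | rfl <;> fin_cases i <;> fin_cases j <;>
    simp [PairType.bracket_apply, PairType.table, iso112]

/-- On span(u₂, u₄) the Ricci tensor is a multiple of g, so the soliton equation makes ad X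
conformal there. It is also singular, and the plane is definite because g is Hermitian, so ad X
vanishes. -/
theorem isEinstein_of_isPseudoKahler_t112_67 {τ : PairType 1} (hτ : τ = .t112_6 ∨ τ = .t112_7)
    (hB : IsAdaptedBasis τ B) (ha : a ≠ 0) (hd : (rotationMetric a b c d).det ≠ 0)
    (hr : r * r + s * t = -1) (hsol : IsRicciSoliton B (rotationMetric a b c d) X lam)
    (h : IsPseudoKahler B (rotationMetric a b c d) (rotationComplex ε r s t)) :
    IsEinstein B (rotationMetric a b c d) := by
  have ht := (ne_zero_of_mul_self_add hr).2
  obtain ⟨e1, e2, e3⟩ := hermitian_of_rotation hr h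
  rw [det_rotationMetric] at hd
  have hD := right_ne_zero_of_mul hd
  have hb : b ≠ 0 := by
    rintro rfl
    have h0 := (mul_eq_zero.1 e1.symm).resolve_right ht
    rw [h0] at e2
    simp [e2] at hD
  obtain ⟨r1, r2, r3⟩ := ricci_t112_67 hτ hB ha hb hD rfl
  have hX := adMat_mVec_t112_67 hτ hB X
  have q := fun i j => congrFun (congrFun hsol i) j
  have q1 := q 1 1
  have q2 := q 1 3
  have q3 := q 3 3
  simp only [Matrix.add_apply, lieDerivMetric, hX, r1, r2, r3] at q1 q2 q3
  simp [Matrix.mul_apply, Fin.sum_univ_four, -mul_eq_zero] at q1 q2 q3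
  -- The value of the curvature plays no role: any multiple of g would do.
  generalize -b / (b * d - c ^ 2) = κ at q1 q2 q3
  have m1 : κ - lam = 2 * X 3 := mul_right_cancel₀ hb (by linarith)
  have m2 : b * X 1 = -(X 3 * c) := by linear_combination q2 - c * m1
  have m3 : X 3 * (b * d - c ^ 2) = 0 := by
    linear_combination (1 / 2) * b * q3 - (1 / 2) * b * d * m1 - c * m2
  have hX3 : X 3 = 0 := (mul_eq_zero.1 m3).resolve_right hD
  have hX1 : X 1 = 0 := by
    rw [hX3, zero_mul, neg_zero] at m2
    exact (mul_eq_zero.1 m2).resolve_left hb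
  apply isEinstein_of_adMat_eq_zero hsol
  rw [hX, hX1, hX3]
  ext i j
  fin_cases i <;> fin_cases j <;> simp

/-- The operators on span(u₂, u₄) that commute with its complex structure form a field, and ad X is
singular there. -/
theorem adMat_eq_zero_of_holomorphic_t112_67 {τ : PairType 1} (hτ : τ = .t112_6 ∨ τ = .t112_7)
    (hB : IsAdaptedBasis τ B) (hr : r * r + s * t = -1)
    (h : lieDerivComplex B X (rotationComplex ε r s t) = 0) : adMat B (mVec B X) = 0 := by
  obtain ⟨hs, ht⟩ := ne_zero_of_mul_self_add hr
  have hX := adMat_mVec_t112_67 hτ hB X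
  have q := fun i j => congrFun (congrFun h i) j
  have q1 := q 1 1
  have q2 := q 1 3
  simp only [lieDerivComplex, Matrix.sub_apply, hX, Matrix.mul_apply, Fin.sum_univ_four] at q1 q2
  simp [-mul_eq_zero] at q1 q2
  have hX1 : X 1 = 0 := (mul_eq_zero.1 (by linarith : X 1 * t = 0)).resolve_right ht
  rw [hX1] at q2
  have hX3 : X 3 = 0 := (mul_eq_zero.1 (by linarith : X 3 * s = 0)).resolve_right hs
  rw [hX, hX1, hX3]
  ext i j
  fin_cases i <;> fin_cases j <;> simp

theorem adMat_eq_zero_of_holomorphic_t112_1 (hB : IsAdaptedBasis .t112_1 B)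
    (hr : r * r + s * t = -1)
    (h : lieDerivComplex B X (rotationComplex ε r s t) = 0) : adMat B (mVec B X) = 0 := by
  obtain ⟨hs, ht⟩ := ne_zero_of_mul_self_add hr
  have hX : adMat B (mVec B X) = !![-X 3, 0, 0, X 0; X 2, -2 * X 3, -X 0, 2 * X 1;
      0, 0, -X 3, X 2; 0, 0, 0, 0] := by
    ext i j
    rw [adMat_mVec, hB.mBracket_single_right]
    fin_cases i <;> fin_cases j <;>
      simp [PairType.bracket_apply, PairType.table, iso112] <;> ring
  have q := fun i j => congrFun (congrFun h i) j
  have q1 := q 1 1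
  have q2 := q 1 3
  have q3 := q 0 1
  have q4 := q 2 1
  simp only [lieDerivComplex, Matrix.sub_apply, hX, Matrix.mul_apply, Fin.sum_univ_four]
    at q1 q2 q3 q4
  simp [-mul_eq_zero] at q1 q2 q3 q4
  have hX1 : X 1 = 0 := (mul_eq_zero.1 (by linarith : X 1 * t = 0)).resolve_right ht
  rw [hX1] at q2
  have hX3 : X 3 = 0 := (mul_eq_zero.1 (by linarith : X 3 * s = 0)).resolve_right hs
  have hX0 : X 0 = 0 := (mul_eq_zero.1 q3).resolve_right ht
  have hX2 : X 2 = 0 := (mul_eq_zero.1 q4).resolve_right ht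
  rw [hX, hX0, hX1, hX2, hX3]
  ext i j
  fin_cases i <;> fin_cases j <;> simp

end Rotation

/-! ### Case distinction over the list of pairs -/

section Assembly

variable {𝔤 : Type*} [LieRing 𝔤] [LieAlgebra ℝ 𝔤]

theorem IsInvariantMetric.exists_shiftMetric {t : PairType 1} {B : Module.Basis (PairIdx 1) ℝ 𝔤}
    {G : Matrix (Fin 4) (Fin 4) ℝ} (hG : IsInvariantMetric B G) (hB : IsAdaptedBasis t B)
    (hi : t.isotropy = ![shift]) : ∃ a b c d : ℝ, a ≠ 0 ∧ G = shiftMetric a b c d := by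
  refine exists_metric_of_shift hG.symm hG.nondeg ?_
  simpa [hB.adMat_isotropy, hi] using hG.invariant 0

theorem IsInvariantMetric.exists_rotationMetric {t : PairType 1}
    {B : Module.Basis (PairIdx 1) ℝ 𝔤} {G : Matrix (Fin 4) (Fin 4) ℝ}
    (hG : IsInvariantMetric B G) (hB : IsAdaptedBasis t B)
    (hi : t.isotropy = ![rotation]) : ∃ a b c d : ℝ, a ≠ 0 ∧ G = rotationMetric a b c d := by
  refine exists_metric_of_rotation hG.symm hG.nondeg ?_
  simpa [hB.adMat_isotropy, hi] using hG.invariant 0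

theorem IsInvariantAlmostComplex.exists_shiftComplex {t : PairType 1}
    {B : Module.Basis (PairIdx 1) ℝ 𝔤} {J : Matrix (Fin 4) (Fin 4) ℝ}
    (hJ : IsInvariantAlmostComplex B J) (hB : IsAdaptedBasis t B)
    (hi : t.isotropy = ![shift]) :
    ∃ r s t c₁ c₂ c₃ : ℝ, r * r + s * t = -1 ∧ J = shiftComplex r s t c₁ c₂ c₃ := by
  refine exists_complex_of_shift hJ.sq ?_
  simpa [hB.adMat_isotropy, hi] using hJ.invariant 0

theorem IsInvariantAlmostComplex.exists_rotationComplex {t : PairType 1}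
    {B : Module.Basis (PairIdx 1) ℝ 𝔤} {J : Matrix (Fin 4) (Fin 4) ℝ}
    (hJ : IsInvariantAlmostComplex B J) (hB : IsAdaptedBasis t B)
    (hi : t.isotropy = ![rotation]) :
    ∃ ε r s t : ℝ, ε * ε = 1 ∧ r * r + s * t = -1 ∧ J = rotationComplex ε r s t := by
  refine exists_complex_of_rotation hJ.sq ?_
  simpa [hB.adMat_isotropy, hi] using hJ.invariant 0

theorem isEinstein_of_ricci_eq_zero {n : ℕ} {B : Module.Basis (PairIdx n) ℝ 𝔤}
    {G : Matrix (Fin 4) (Fin 4) ℝ} (h : ricci B G = 0) : IsEinstein B G :=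
  ⟨0, by rw [h, zero_smul]⟩

/-- On the pairs of type `1.3¹`, every invariant pseudo-Kähler metric is Einstein. -/
theorem isEinstein_of_isPseudoKahler_of_shift {τ : PairType 1} (ht : τ.Admissible)
    (hi : τ.isotropy = ![shift]) {B : Module.Basis (PairIdx 1) ℝ 𝔤} (hB : IsAdaptedBasis τ B)
    {G J : Matrix (Fin 4) (Fin 4) ℝ} (hG : IsInvariantMetric B G) (h : IsPseudoKahler B G J) :
    IsEinstein B G := by
  obtain ⟨a, b, c, d, ha, rfl⟩ := hG.exists_shiftMetric hB hi
  obtain ⟨r, s, t, c₁, c₂, c₃, hr, rfl⟩ := h.almostComplex.exists_shiftComplex hB hi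
  cases τ with
  | t131_1 =>
    exact isEinstein_of_ricci_eq_zero (ricci_eq_zero_of_isPseudoKahler_t131_1 hB ha hr h)
  | t131_2 => exact absurd h (not_isPseudoKahler_t131_2 hB ha hr)
  | t131_3 => exact absurd h (not_isPseudoKahler_t131_3 hB)
  | t131_5 =>
    exact isEinstein_of_ricci_eq_zero (ricci_eq_zero_of_isPseudoKahler_t131_5 ht.2 hB ha hr h)
  | t131_6 => exact absurd h (not_isPseudoKahler_t131_6 hB ha hr)
  | t131_7 => exact absurd h (not_isPseudoKahler_t131_7 ht hB ha hr)
  | t131_8 => exact absurd h (not_isPseudoKahler_t131_8 hB ha hr)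
  | t131_9 => exact absurd h (not_isPseudoKahler_t131_9 ht hB ha hr)
  | t131_11 => exact absurd h (not_isPseudoKahler_t131_11 hB ha hr)
  | t131_12 =>
    exact isEinstein_of_ricci_eq_zero (ricci_eq_zero_of_isPseudoKahler_t131_12 hB ha hr h)
  | t131_13 => exact absurd h (not_isPseudoKahler_t131_13 hB ha hr)
  | t131_14 => exact absurd h (not_isPseudoKahler_t131_14 hB ha hr)
  | t131_19 => exact absurd h (not_isPseudoKahler_t131_19 hB ha hr)
  | t131_20 => exact absurd h (not_isPseudoKahler_t131_20 hB ha hr)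
  | t131_21 => exact absurd h (not_isPseudoKahler_t131_21 hB ha hr)
  | t131_22 => exact absurd h (not_isPseudoKahler_t131_22 hB ha hr)
  | t131_28 => exact absurd h (not_isPseudoKahler_t131_28 hB ha hr)
  | _ =>
    -- The entry (0, 2) is 1 for `shift`, -1 for `rotation` and 0 for `boost` and `nullRotation`, so
    -- it excludes the other families.
    have := congrFun (congrFun (congrFun hi 0) 0) 2
    simp [PairType.isotropy] at this <;> norm_num at this

/-- On the pairs of type `1.1²`, every pseudo-Kähler Ricci soliton is Einstein. -/
theorem isEinstein_of_isPseudoKahler_of_rotation {τ : PairType 1}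
    (hi : τ.isotropy = ![rotation]) {B : Module.Basis (PairIdx 1) ℝ 𝔤} (hB : IsAdaptedBasis τ B)
    {G J : Matrix (Fin 4) (Fin 4) ℝ} (hG : IsInvariantMetric B G) {X : Fin 4 → ℝ} {lam : ℝ}
    (hsol : IsRicciSoliton B G X lam) (h : IsPseudoKahler B G J) : IsEinstein B G := by
  obtain ⟨a, b, c, d, ha, rfl⟩ := hG.exists_rotationMetric hB hi
  obtain ⟨ε, r, s, t, hε, hr, rfl⟩ := h.almostComplex.exists_rotationComplex hB hi
  cases τ with
  | t112_1 => exact isEinstein_of_isPseudoKahler_t112_1 hB ha hε hr h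
  | t112_2 => exact absurd h (not_isPseudoKahler_t112_2 hB ha hε)
  | t112_6 =>
    exact isEinstein_of_isPseudoKahler_t112_67 (Or.inl rfl) hB ha hG.nondeg hr hsol h
  | t112_7 =>
    exact isEinstein_of_isPseudoKahler_t112_67 (Or.inr rfl) hB ha hG.nondeg hr hsol h
  | _ =>
    have := congrFun (congrFun (congrFun hi 0) 0) 2
    simp [PairType.isotropy] at this <;> norm_num at this

/-- A holomorphic vector field on one of the candidate pairs acts trivially on `𝔪`. -/
theorem adMat_eq_zero_of_isCandidate {n : ℕ} {t : PairType n} (ht : t.IsCandidate)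
    {B : Module.Basis (PairIdx n) ℝ 𝔤} (hB : IsAdaptedBasis t B) {J : Matrix (Fin 4) (Fin 4) ℝ}
    (hJ : IsInvariantAlmostComplex B J) {X : Fin 4 → ℝ} (h : lieDerivComplex B X J = 0) :
    adMat B (mVec B X) = 0 := by
  cases t with
  | t112_1 =>
    obtain ⟨ε, r, s, t, -, hr, rfl⟩ := hJ.exists_rotationComplex hB rfl
    exact adMat_eq_zero_of_holomorphic_t112_1 hB hr h
  | t112_6 =>
    obtain ⟨ε, r, s, t, -, hr, rfl⟩ := hJ.exists_rotationComplex hB rfl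
    exact adMat_eq_zero_of_holomorphic_t112_67 (Or.inl rfl) hB hr h
  | t112_7 =>
    obtain ⟨ε, r, s, t, -, hr, rfl⟩ := hJ.exists_rotationComplex hB rfl
    exact adMat_eq_zero_of_holomorphic_t112_67 (Or.inr rfl) hB hr h
  | _ => exact ht.elim

theorem nullRotation_mul_self : nullRotation * nullRotation = Matrix.single 0 2 1 := by
  ext i j
  fin_cases i <;> fin_cases j <;> simp [Matrix.mul_apply, Fin.sum_univ_four, Matrix.single]

/-- On all the pairs in the list, every pseudo-Kähler Ricci soliton is Einstein. -/
theorem isEinstein_of_isPseudoKahler {n : ℕ} {t : PairType n} (ht : t.Admissible)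
    {B : Module.Basis (PairIdx n) ℝ 𝔤} (hB : IsAdaptedBasis t B)
    {G J : Matrix (Fin 4) (Fin 4) ℝ} (hG : IsInvariantMetric B G) {X : Fin 4 → ℝ} {lam : ℝ}
    (hsol : IsRicciSoliton B G X lam) (h : IsPseudoKahler B G J) : IsEinstein B G := by
  have hJ := h.almostComplex
  have hne : (-1 : ℝ) ≠ 0 := by norm_num
  cases t with
  | t111_1 | t111_2 | t111_5 | t221_2 | t221_3 =>
    exact absurd rfl (hB.isotropy_ne_boost hJ 0)
  | t141_2 | t141_9 | t141_10 | t141_11 | t141_12 | t141_15 | t141_16 | t141_17 | t141_21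
  | t141_22 => exact absurd nullRotation_mul_self (hB.isotropy_mul_ne hJ 0 0 one_ne_zero)
  | t251_3 | t251_4 =>
    refine absurd ?_ (hB.isotropy_mul_ne hJ 0 1 hne)
    ext i j
    fin_cases i <;> fin_cases j <;>
      simp [PairType.isotropy, Matrix.mul_apply, Fin.sum_univ_four, Matrix.single]
  | t252_2 =>
    refine absurd ?_ (hB.isotropy_mul_ne hJ 0 0 hne)
    ext i j
    fin_cases i <;> fin_cases j <;>
      simp [PairType.isotropy, Matrix.mul_apply, Fin.sum_univ_four, Matrix.single]
  | t331_1 => exact absurd rfl (hB.isotropy_ne_diagonal hJ 0)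
  | t332_1 =>
    refine absurd ?_ (hB.isotropy_mul_ne hJ 1 1 hne)
    ext i j
    fin_cases i <;> fin_cases j <;>
      simp [PairType.isotropy, Matrix.mul_apply, Fin.sum_univ_four, Matrix.single]
  | t112_1 | t112_2 | t112_6 | t112_7 =>
    exact isEinstein_of_isPseudoKahler_of_rotation rfl hB hG hsol h
  | _ => exact isEinstein_of_isPseudoKahler_of_shift ht rfl hB hG h

end Assembly

end HomSoliton

open HomSoliton in
theorem theorem4p4 {n : ℕ} (t : PairType n) (ht : t.Admissible)
    {𝔤 : Type*} [LieRing 𝔤] [LieAlgebra ℝ 𝔤]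
    (B : Module.Basis (PairIdx n) ℝ 𝔤) (hB : IsAdaptedBasis t B)
    (G : Matrix (Fin 4) (Fin 4) ℝ) (hG : IsInvariantMetric B G)
    (X : Fin 4 → ℝ) (lam : ℝ) (hsol : IsRicciSoliton B G X lam) (hne : ¬ IsEinstein B G) :
    (¬ ∃ J : Matrix (Fin 4) (Fin 4) ℝ, IsPseudoKahler B G J) ∧
      (t.IsCandidate → ∀ J : Matrix (Fin 4) (Fin 4) ℝ,
        IsInvariantAlmostComplex B J → lieDerivComplex B X J ≠ 0) := by
  refine ⟨fun ⟨J, hJ⟩ => hne (isEinstein_of_isPseudoKahler ht hB hG hsol hJ),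
    fun hc J hJ h => hne (isEinstein_of_adMat_eq_zero hsol ?_)⟩
  exact adMat_eq_zero_of_isCandidate hc hB hJ h
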